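/- Let $N\in\mathbb N$ and, for every $n\ge 1$, let $w_{nj}$, $j=1,\dots,p_n$, be similarities of $\mathbb R^N$ with common ratio $\lambda_n\in(0,1)$, where $p_n\ge 2$ and $\sup_n p_n<\infty$. Assume the regular open set condition: there is a nonempty bounded open set $V\subset\mathbb R^N$ such that $w_{nj}(V)\subset V$ for all $n,j$, $w_{ni}(V)\cap w_{nj}(V)=\emptyset$ for all $n$ and $i\neq j$, the Lebesgue measures of $V$ and of $\overline V$ are equal, and $V$ is the interior of $\overline V$. Let $\Sigma_n$ be the set of words $\sigma$ of length $n$ with $\sigma(k)\in\{1,\dots,p_k\}$, $w_\sigma=w_{1\sigma(1)}\circ\dots\circ w_{n\sigma(n)}$ and $P_n=p_1\cdots p_n$. Let $F=\bigcap_n\bigcup_{\sigma\in\Sigma_n}w_\sigma(\overline V)$ be the associated translation fractal. There is a unique Borel probability measure $\mu$ on $\mathbb R^N$ (the canonical limit measure) which, for every Borel probability measure $\mu_0$ on $\mathbb R^N$, is the weak limit of $\mu_n(A)=P_n^{-1}\sum_{\sigma\in\Sigma_n}\mu_0(w_\sigma^{-1}(A))$. It satisfies $\mu(\mathbb R^N\setminus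 F)=0$, and, writing $B_F(y,r)=F\cap B(y,r)$ with $B(y,r)$ the open ball, the following hold. 1. For every $x\in F$ there are $R,C>0$ such that $C^{-1}\mu(B_F(x,r))\le\mu(B_F(y,r))\le C\,\mu(B_F(x,r))$ for all $y\in B_F(x,R)$ and $r\in(0,R)$. 2. For every $x\in F$, $\underline\delta_F(x)=\underline\delta_\mu(x)$ and $\overline\delta_F(x)=\overline\delta_\mu(x)$, where $$\underline\delta_\mu(x)=\liminf_{\lambda\to0}\liminf_{r\to0}\frac{\log\big(\mu(B(x,r))/\mu(B(x,\lambda r))\big)}{\log 1/\lambda},\qquad \underline\delta_F(x)=\liminf_{\lambda\to0}\liminf_{r\to0}\frac{\log n(\lambda r,F\cap\overline B(x,r))}{\log 1/\lambda},$$ $n(r,E)$ is the minimum number of open balls of radius $r$ needed to cover $E$, and $\overline\delta_\mu(x)$, $\overline\delta_F(x)$ are defined with $\limsup$ in place of $\liminf$. 3. For every $x\in F$, $$\underline\delta_\mu(x)=\inf_{\nu\in T_x(\mu)}\underline d_\nu(x),\qquad \overline\delta_\mu(x)=\sup_{\nu\in T_x(\mu)}\overline d_\nu(x).$$ Here $T_x(\mu)$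 is the set of tangent measures of $\mu$ at $x$: the nonzero Radon measures that are vague limits of $c_n\,\mu\circ D_x^{l_n}$ with $c_n>0$, $l_n>0$ decreasing to $0$, and $D_x^{l}(y)=x+l(y-x)$. The numbers $\underline d_\nu(x)$ and $\overline d_\nu(x)$ are the $\liminf$ and $\limsup$ as $r\to0$ of $\log\nu(B(x,r))/\log r$. 4. For every $x\in F$, $$\underline\delta_F(x)=\inf_{T}\underline d(T)=\inf_{T}\overline d(T),\qquad \overline\delta_F(x)=\sup_{T}\underline d(T)=\sup_{T}\overline d(T).$$ Here $T=(T,o)$ runs over the tangent sets of $F$ at $x$: the pointed proper metric spaces that are pointed Gromov--Hausdorff limits of $(F,s_n d,x)$ for some $s_n\to\infty$, with $d$ the Euclidean distance. The numbers $\underline d(T)$ and $\overline d(T)$ are the local dimensions of $T$ at its base point, $\underline d(T)=\lim_{R\to0}\liminf_{r\to0}\log n(r,B_T(o,R))/\log(1/r)$, and $\overline d(T)$ is the same with $\limsup$ in $r$. -/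

import Mathlib

open Set Filter Topology MeasureTheory
open scoped ENNReal NNReal BoundedContinuousFunction

noncomputable section

namespace TangentialDim

/-! ### Dimensions of measures -/

section Measures

variable {M : Type*} [MetricSpace M] [MeasurableSpace M]

/-- Lower local dimension of `μ` at `x`: `liminf_{r → 0} log μ(B(x,r)) / log r`.
It is `⊤` when `μ` vanishes near `x`, since `log 0 = ⊥` and `log r < 0`. -/
def lowerLocalDim (μ : Measure M) (x : M) : EReal :=
  liminf (fun r : ℝ => ENNReal.log (μ (Metric.ball x r)) / ((Real.log r : ℝ) : EReal)) (𝓝[>] 0)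

/-- Upper local dimension of `μ` at `x`. -/
def upperLocalDim (μ : Measure M) (x : M) : EReal :=
  limsup (fun r : ℝ => ENNReal.log (μ (Metric.ball x r)) / ((Real.log r : ℝ) : EReal)) (𝓝[>] 0)

/-- Lower tangential dimension of `μ` at `x`. -/
def lowerTangDim (μ : Measure M) (x : M) : EReal :=
  liminf (fun l : ℝ =>
    liminf (fun r : ℝ =>
      ENNReal.log (μ (Metric.ball x r) / μ (Metric.ball x (l * r))) /
        ((Real.log (1 / l) : ℝ) : EReal)) (𝓝[>] 0)) (𝓝[>] 0)

/-- Upper tangential dimension of `μ` at `x`. -/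
def upperTangDim (μ : Measure M) (x : M) : EReal :=
  limsup (fun l : ℝ =>
    limsup (fun r : ℝ =>
      ENNReal.log (μ (Metric.ball x r) / μ (Metric.ball x (l * r))) /
        ((Real.log (1 / l) : ℝ) : EReal)) (𝓝[>] 0)) (𝓝[>] 0)

/-- For a measure `μ` carried by the subspace `X`: every `x ∈ X` has constants `R, C > 0` such that
`C⁻¹ μ(B_X(x,r)) ≤ μ(B_X(y,r)) ≤ C μ(B_X(x,r))` for all `y ∈ B_X(x,R)` and `r ∈ (0,R)`,
where `B_X(y,r) = B(y,r) ∩ X` are the balls of the metric space `X`. -/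
def LocallyComparableBalls (X : Set M) (μ : Measure M) : Prop :=
  ∀ x ∈ X, ∃ (R : ℝ) (C : ℝ≥0), 0 < R ∧ 0 < C ∧
    ∀ y ∈ Metric.ball x R ∩ X, ∀ r ∈ Ioo 0 R,
      (C : ℝ≥0∞)⁻¹ * μ (Metric.ball x r ∩ X) ≤ μ (Metric.ball y r ∩ X) ∧
      μ (Metric.ball y r ∩ X) ≤ (C : ℝ≥0∞) * μ (Metric.ball x r ∩ X)

end Measures

/-! ### Tangent measures on `ℝ^N` -/

/-- The measure `μ ∘ D`, that is `A ↦ μ (D A)`, where `D y = x + l (y - x)` is the dilation with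
center `x` and factor `l > 0`; it is the image of `μ` under the inverse of `D`. -/
def dilate {N : ℕ} (μ : Measure (EuclideanSpace ℝ (Fin N))) (x : EuclideanSpace ℝ (Fin N))
    (l : ℝ) : Measure (EuclideanSpace ℝ (Fin N)) :=
  μ.map (fun y => x + l⁻¹ • (y - x))

/-- The cone of tangent measures of `μ` at `x`: nonzero Radon measures that are limits, in the vague
topology, of `c_n μ ∘ D_x^{l_n}` with `c_n > 0` and `l_n > 0` decreasing to `0`.
On `ℝ^N` a Radon measure is the same as a locally finite Borel measure. -/
def tangentMeasures {N : ℕ} (μ : Measure (EuclideanSpace ℝ (Fin N)))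
    (x : EuclideanSpace ℝ (Fin N)) : Set (Measure (EuclideanSpace ℝ (Fin N))) :=
  {ν | IsLocallyFiniteMeasure ν ∧ ν ≠ 0 ∧
    ∃ c l : ℕ → ℝ, (∀ n, 0 < c n) ∧ (∀ n, 0 < l n) ∧ Antitone l ∧ Tendsto l atTop (𝓝 0) ∧
      ∀ f : EuclideanSpace ℝ (Fin N) → ℝ, Continuous f → HasCompactSupport f →
        Tendsto (fun n => c n * ∫ y, f y ∂(dilate μ x (l n))) atTop (𝓝 (∫ y, f y ∂ν))}

/-! ### Dimensions of metric spaces -/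

section Sets

variable {M : Type*} [MetricSpace M]

/-- `n(r, E)`: the minimum number of open balls of radius `r` needed to cover `E`
(`⊤` if no finite family does). -/
def coverNumber (r : ℝ) (E : Set M) : ℕ∞ :=
  ⨅ (S : Set M) (_ : E ⊆ ⋃ y ∈ S, Metric.ball y r), S.encard

/-- Lower tangential dimension of the set `E` at `x`. -/
def lowerTangDimSet (E : Set M) (x : M) : EReal :=
  liminf (fun l : ℝ =>
    liminf (fun r : ℝ =>
      ENNReal.log (coverNumber (l * r) (E ∩ Metric.closedBall x r) : ℝ≥0∞) /
        ((Real.log (1 / l) : ℝ) : EReal)) (𝓝[>] 0)) (𝓝[>] 0)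

/-- Upper tangential dimension of the set `E` at `x`. -/
def upperTangDimSet (E : Set M) (x : M) : EReal :=
  limsup (fun l : ℝ =>
    limsup (fun r : ℝ =>
      ENNReal.log (coverNumber (l * r) (E ∩ Metric.closedBall x r) : ℝ≥0∞) /
        ((Real.log (1 / l) : ℝ) : EReal)) (𝓝[>] 0)) (𝓝[>] 0)

/-- Lower local (box) dimension of a metric space at `x`,
`lim_{R → 0} liminf_{r → 0} log n(r, B(x,R)) / log (1/r)`.
The inner `liminf` is monotone in `R`, so that its limit is an infimum. -/
def lowerLocalBoxDim (x : M) : EReal :=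
  ⨅ (R : ℝ) (_ : 0 < R),
    liminf (fun r : ℝ =>
      ENNReal.log (coverNumber r (Metric.ball x R) : ℝ≥0∞) /
        ((Real.log (1 / r) : ℝ) : EReal)) (𝓝[>] 0)

/-- Upper local (box) dimension of a metric space at `x`. -/
def upperLocalBoxDim (x : M) : EReal :=
  ⨅ (R : ℝ) (_ : 0 < R),
    limsup (fun r : ℝ =>
      ENNReal.log (coverNumber r (Metric.ball x R) : ℝ≥0∞) /
        ((Real.log (1 / r) : ℝ) : EReal)) (𝓝[>] 0)

end Sets

/-! ### Tangent sets in the sense of Gromov -/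

/-- A proper metric space with a base point. -/
structure PointedProperSpace where
  carrier : Type
  [metric : MetricSpace carrier]
  [proper : ProperSpace carrier]
  base : carrier

attribute [instance] PointedProperSpace.metric PointedProperSpace.proper

/-- Pointed Gromov-Hausdorff convergence of the rescaled spaces `(X, s_n d, x)` to `(T, o)`: for all
`r, ε > 0` and all large `n` there is a map `f` from the ball of radius `r` about `x` in
`(X, s_n d)` to `T`, with `f x = o` and distortion less than `ε`, such that the `ε`-neighbourhood of
the image of that ball contains the ball of radius `r - ε` about `o`. (The values of `f` outside the
ball play no role.) -/
def PointedGHTendsto {M : Type*} [MetricSpace M] (X : Set M) (x : M) (s : ℕ → ℝ)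
    (T : PointedProperSpace) : Prop :=
  ∀ r > 0, ∀ ε > 0, ∀ᶠ n in atTop, ∃ f : M → T.carrier,
    f x = T.base ∧
    (∀ y ∈ X, ∀ z ∈ X, s n * dist y x < r → s n * dist z x < r →
      |dist (f y) (f z) - s n * dist y z| < ε) ∧
    (∀ t : T.carrier, dist t T.base < r - ε →
      ∃ y ∈ X, s n * dist y x < r ∧ dist t (f y) < ε)

/-- The tangent sets of `X` at `x`: pointed Gromov-Hausdorff limit points of `(X, s d, x)` as
`s → ∞`. -/
def tangentSets {M : Type*} [MetricSpace M] (X : Set M) (x : M) : Set PointedProperSpace :=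
  {T | ∃ s : ℕ → ℝ, Tendsto s atTop atTop ∧ PointedGHTendsto X x s T}

/-! ### Translation fractals (the sequence of families of maps is indexed from `0`) -/

section Fractal

variable {N : ℕ} {p : ℕ → ℕ}

/-- The composition `w_{0,σ(0)} ∘ ⋯ ∘ w_{n-1,σ(n-1)}` for a word `σ` of length `n`. -/
def wordMap (w : (n : ℕ) → Fin (p n) → EuclideanSpace ℝ (Fin N) → EuclideanSpace ℝ (Fin N)) :
    (n : ℕ) → ((k : Fin n) → Fin (p k)) → EuclideanSpace ℝ (Fin N) → EuclideanSpace ℝ (Fin N)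
  | 0, _ => id
  | n + 1, σ => wordMap w n (fun k => σ k.castSucc) ∘ w n (σ (Fin.last n))

/-- The maps `w_{nj}` satisfy the regular open set condition with the open set `V`. -/
structure RegularOpenSetCondition
    (w : (n : ℕ) → Fin (p n) → EuclideanSpace ℝ (Fin N) → EuclideanSpace ℝ (Fin N))
    (V : Set (EuclideanSpace ℝ (Fin N))) : Prop where
  nonempty : V.Nonempty
  bounded : Bornology.IsBounded V
  isOpen : IsOpen V
  image_subset : ∀ n j, w n j '' V ⊆ V
  disjoint : ∀ n i j, i ≠ j → Disjoint (w n i '' V) (w n j '' V)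
  volume_closure : volume V = volume (closure V)
  interior_closure : interior (closure V) = V

/-- The translation fractal: the intersection of the decreasing compact sets
`W_0 ∘ ⋯ ∘ W_{n-1} (closure V)`, where `W_n K = ⋃_j w_{nj} K`. -/
def translationFractal
    (w : (n : ℕ) → Fin (p n) → EuclideanSpace ℝ (Fin N) → EuclideanSpace ℝ (Fin N))
    (V : Set (EuclideanSpace ℝ (Fin N))) : Set (EuclideanSpace ℝ (Fin N)) :=
  ⋂ n : ℕ, ⋃ σ : (k : Fin n) → Fin (p k), wordMap w n σ '' closure V

/-- `μ_n(A) = P_n⁻¹ ∑_{|σ| = n} μ₀ (w_σ⁻¹ A)`, where `P_n` is the number of words of length `n`. -/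
def iterMeasure
    (w : (n : ℕ) → Fin (p n) → EuclideanSpace ℝ (Fin N) → EuclideanSpace ℝ (Fin N))
    (μ₀ : Measure (EuclideanSpace ℝ (Fin N))) (n : ℕ) : Measure (EuclideanSpace ℝ (Fin N)) :=
  ((∏ k ∈ Finset.range n, p k : ℕ) : ℝ≥0∞)⁻¹ •
    ∑ σ : ((k : Fin n) → Fin (p k)), μ₀.map (wordMap w n σ)

/-- The canonical limit measure: the Borel probability measure which is the weak limit of the
measures `μ_n`, whatever the Borel probability measure `μ₀` one starts with. -/
structure IsCanonicalLimitMeasure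
    (w : (n : ℕ) → Fin (p n) → EuclideanSpace ℝ (Fin N) → EuclideanSpace ℝ (Fin N))
    (μ : Measure (EuclideanSpace ℝ (Fin N))) : Prop where
  isProbabilityMeasure : IsProbabilityMeasure μ
  tendsto : ∀ μ₀ : Measure (EuclideanSpace ℝ (Fin N)), IsProbabilityMeasure μ₀ →
    ∀ f : EuclideanSpace ℝ (Fin N) →ᵇ ℝ,
      Tendsto (fun n => ∫ y, f y ∂(iterMeasure w μ₀ n)) atTop (𝓝 (∫ y, f y ∂μ))

end Fractal

end TangentialDim

end

open TangentialDim

noncomputable section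

namespace TangentialDim

/-! ### Exponents of real functions of two scales -/

/-! The whole theorem follows from one doubling property, `UniformBalls`: a ball of radius `2r`
centred on the fractal has at most `A` times the mass of any ball of radius `r` centred on the
fractal.

For the canonical measure this is a count of cells. The measure is the image of the uniform measure
on infinite words under the coding map, so each word of length `n` carries mass `1 / P_n`. The open
set condition and a volume comparison bound the number of level-`n` cells that meet a ball of
comparable radius (`exists_card_le`). Since `p` is bounded, passing from one level to the next
changes `1 / P_n` by a bounded factor, however small the ratio is (`exists_uniformBalls`).

Given doubling, every dimension is read off from `incr μ x l r`, the increment of `log μ(B(x,·))`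
from `l * r` to `r`. Packing and covering show that log covering numbers agree with it up to a
bounded error, which disappears after division by `log (1 / l)`. For a tangent measure or tangent
set along scales `r k`, the logarithm that defines its local dimension at `ρ` is within a bounded
error of `incr μ x ρ (r k)` for large `k` (`GrowsLike`). Hence all local dimensions of tangent
objects lie between the two tangential dimensions.

Sharpness comes from a one-variable argument (`exists_scales`): for each `δ` above the lower
tangential dimension there are scales `r k → 0` at which the increments are eventually at most `δ
log (1 / l) + 1`, for every `l` at once. Compactness (`exists_vague_limit` for measures,
`exists_fell_limit` for sets) produces a tangent object along a subsequence, and even its upper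
local dimension is at most `δ`. This is why lower and upper local box dimensions of tangent sets
have the same infimum. The suprema follow by changing signs. -/

/-- `liminf_{l → 0} liminf_{r → 0} q l r / log (1 / l)`. -/
def tangLiminf (q : ℝ → ℝ → ℝ) : EReal :=
  liminf (fun l : ℝ => liminf (fun r : ℝ => ((q l r / Real.log (1 / l) : ℝ) : EReal)) (𝓝[>] 0))
    (𝓝[>] 0)

/-- `limsup_{l → 0} limsup_{r → 0} q l r / log (1 / l)`. -/
def tangLimsup (q : ℝ → ℝ → ℝ) : EReal :=
  limsup (fun l : ℝ => limsup (fun r : ℝ => ((q l r / Real.log (1 / l) : ℝ) : EReal)) (𝓝[>] 0))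
    (𝓝[>] 0)

/-- `liminf_{r → 0} G r / log (1 / r)`. -/
def localLiminf (G : ℝ → ℝ) : EReal :=
  liminf (fun r : ℝ => ((G r / Real.log (1 / r) : ℝ) : EReal)) (𝓝[>] 0)

/-- `limsup_{r → 0} G r / log (1 / r)`. -/
def localLimsup (G : ℝ → ℝ) : EReal :=
  limsup (fun r : ℝ => ((G r / Real.log (1 / r) : ℝ) : EReal)) (𝓝[>] 0)

lemma tangLiminf_neg (q : ℝ → ℝ → ℝ) : tangLiminf (fun l r => -q l r) = -tangLimsup q := by
  unfold tangLiminf tangLimsup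
  rw [← EReal.liminf_neg]
  congr 1
  ext l
  rw [Pi.neg_apply, ← EReal.liminf_neg]
  congr 1
  ext r
  rw [Pi.neg_apply, neg_div, EReal.coe_neg]

lemma localLiminf_neg (G : ℝ → ℝ) : localLiminf (fun r => -G r) = -localLimsup G := by
  unfold localLiminf localLimsup
  rw [← EReal.liminf_neg]
  congr 1
  ext r
  rw [Pi.neg_apply, neg_div, EReal.coe_neg]

lemma localLiminf_le_localLimsup (G : ℝ → ℝ) : localLiminf G ≤ localLimsup G :=
  liminf_le_limsup

lemma tendsto_log_one_div : Tendsto (fun l : ℝ => Real.log (1 / l)) (𝓝[>] 0) atTop := by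
  have := tendsto_neg_atBot_atTop.comp Real.tendsto_log_nhdsGT_zero
  refine this.congr fun l => ?_
  simp

lemma eventually_lt_one : ∀ᶠ l : ℝ in 𝓝[>] 0, l ∈ Ioo (0 : ℝ) 1 :=
  Ioo_mem_nhdsGT one_pos

lemma log_one_div_pos {l : ℝ} (hl : l ∈ Ioo (0 : ℝ) 1) : 0 < Real.log (1 / l) := by
  rw [one_div, Real.log_inv]
  linarith [Real.log_neg hl.1 hl.2]

/-- `C` does not depend on `l` or `r`, so `C / log (1 / l)` tends to `0`: quantities equal up to a
bounded error have the same exponents. -/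
lemma tangLiminf_le_of_le_add {q₁ q₂ : ℝ → ℝ → ℝ} {C : ℝ}
    (h : ∀ l ∈ Ioo (0 : ℝ) 1, ∀ r > 0, q₁ l r ≤ q₂ l r + C) : tangLiminf q₁ ≤ tangLiminf q₂ := by
  refine EReal.ge_of_forall_gt_iff_ge.1 fun c hc => ?_
  obtain ⟨c', hcc', hc'⟩ := EReal.lt_iff_exists_real_btwn.1 hc
  have hcc' : c < c' := by exact_mod_cast hcc'
  refine le_liminf_of_le (h := ?_)
  filter_upwards [eventually_lt_of_lt_liminf hc', eventually_lt_one,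
    tendsto_log_one_div.eventually_ge_atTop (C / (c' - c))] with l hl hl1 hlC
  refine le_liminf_of_le (h := ?_)
  filter_upwards [eventually_lt_of_lt_liminf hl, self_mem_nhdsWithin] with r hr hr0
  have hL := log_one_div_pos hl1
  rw [EReal.coe_lt_coe_iff, lt_div_iff₀ hL] at hr
  rw [EReal.coe_le_coe_iff, le_div_iff₀ hL]
  rw [div_le_iff₀ (sub_pos.2 hcc')] at hlC
  linarith [h l hl1 r hr0]

lemma tangLimsup_le_of_le_add {q₁ q₂ : ℝ → ℝ → ℝ} {C : ℝ}
    (h : ∀ l ∈ Ioo (0 : ℝ) 1, ∀ r > 0, q₁ l r ≤ q₂ l r + C) : tangLimsup q₁ ≤ tangLimsup q₂ := by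
  rw [← EReal.neg_le_neg_iff, ← tangLiminf_neg, ← tangLiminf_neg]
  exact tangLiminf_le_of_le_add (C := C) fun l hl r hr => by linarith [h l hl r hr]

/-- For every small `ρ`, the numbers `q ρ (r k)` are eventually within a bounded distance
of `G ρ`. -/
def GrowsLike (q : ℝ → ℝ → ℝ) (r : ℕ → ℝ) (G : ℝ → ℝ) : Prop :=
  ∃ C : ℝ, ∀ᶠ ρ in 𝓝[>] (0 : ℝ), ∀ᶠ k in atTop, |G ρ - q ρ (r k)| ≤ C

namespace GrowsLike

variable {q : ℝ → ℝ → ℝ} {r : ℕ → ℝ} {G : ℝ → ℝ}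

lemma neg (h : GrowsLike q r G) : GrowsLike (fun l r => -q l r) r (fun ρ => -G ρ) := by
  obtain ⟨C, hC⟩ := h
  refine ⟨C, ?_⟩
  filter_upwards [hC] with ρ hρ
  filter_upwards [hρ] with k hk
  rwa [← abs_neg, show -(-G ρ - -q ρ (r k)) = G ρ - q ρ (r k) by ring]

/-- For each `ρ` a single large `k` is enough, because `G ρ` does not depend on `k`. -/
lemma tangLiminf_le (h : GrowsLike q r G) (hr : Tendsto r atTop (𝓝[>] 0)) :
    tangLiminf q ≤ localLiminf G := by
  obtain ⟨C, hC⟩ := h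
  refine EReal.ge_of_forall_gt_iff_ge.1 fun c hc => ?_
  obtain ⟨c', hcc', hc'⟩ := EReal.lt_iff_exists_real_btwn.1 hc
  have hcc' : c < c' := by exact_mod_cast hcc'
  refine le_liminf_of_le (h := ?_)
  filter_upwards [eventually_lt_of_lt_liminf hc', eventually_lt_one, hC,
    tendsto_log_one_div.eventually_ge_atTop (C / (c' - c))] with l hl hl1 hlG hlC
  obtain ⟨k, hk1, hk2⟩ := ((hr.eventually (eventually_lt_of_lt_liminf hl)).and hlG).exists
  have hL := log_one_div_pos hl1
  rw [EReal.coe_lt_coe_iff, lt_div_iff₀ hL] at hk1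
  rw [EReal.coe_le_coe_iff, le_div_iff₀ hL]
  rw [div_le_iff₀ (sub_pos.2 hcc')] at hlC
  linarith [(abs_le.1 hk2).1]

lemma le_tangLimsup (h : GrowsLike q r G) (hr : Tendsto r atTop (𝓝[>] 0)) :
    localLimsup G ≤ tangLimsup q := by
  rw [← EReal.neg_le_neg_iff, ← tangLiminf_neg, ← localLiminf_neg]
  exact h.neg.tangLiminf_le hr

lemma localLimsup_le (h : GrowsLike q r G) {δ : ℝ}
    (hδ : ∀ l ∈ Ioo (0 : ℝ) 1, ∀ᶠ k in atTop, q l (r k) ≤ δ * Real.log (1 / l) + 1) :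
    localLimsup G ≤ δ := by
  obtain ⟨C, hC⟩ := h
  refine EReal.le_of_forall_lt_iff_le.1 fun c hc => ?_
  have hcc' : δ < c := by exact_mod_cast hc
  refine limsup_le_of_le (h := ?_)
  filter_upwards [eventually_lt_one, hC,
    tendsto_log_one_div.eventually_ge_atTop ((C + 1) / (c - δ))] with l hl1 hlG hlC
  obtain ⟨k, hk1, hk2⟩ := ((hδ l hl1).and hlG).exists
  have hL := log_one_div_pos hl1
  rw [EReal.coe_le_coe_iff, div_le_iff₀ hL]
  rw [div_le_iff₀ (sub_pos.2 hcc')] at hlC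
  linarith [(abs_le.1 hk2).2]

lemma le_localLiminf (h : GrowsLike q r G) {δ : ℝ}
    (hδ : ∀ l ∈ Ioo (0 : ℝ) 1, ∀ᶠ k in atTop, δ * Real.log (1 / l) - 1 ≤ q l (r k)) :
    δ ≤ localLiminf G := by
  have := h.neg.localLimsup_le (δ := -δ) fun l hl => (hδ l hl).mono fun k hk => by linarith
  rw [← EReal.neg_le_neg_iff, ← EReal.coe_neg]
  have h2 := localLiminf_neg (fun r => - G r)
  simp only [neg_neg] at h2
  rw [h2, neg_neg]
  exact this

end GrowsLike

/-- A nearly maximising point of `f` on `[a, a + T]` which is not in the last part of length `S`. -/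
lemma exists_near_max {f : ℝ → ℝ} {a T S B : ℝ} (hS : 0 ≤ S) (hST : S ≤ T)
    (hB : ∀ t ∈ Icc a (a + T), f t ≤ B) (hlast : ∀ t ∈ Icc (a + T - S) (a + T), f t < f a) :
    ∃ t ≥ a, ∀ s ∈ Icc 0 S, f (t + s) ≤ f t + 1 := by
  have haT : a ∈ Icc a (a + T) := ⟨le_rfl, by linarith⟩
  have hbdd : BddAbove (f '' Icc a (a + T)) := ⟨B, by rintro _ ⟨t, ht, rfl⟩; exact hB t ht⟩
  set m := sSup (f '' Icc a (a + T)) with hm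
  -- The supremum need not be attained, so a point within `1` of it is taken. Keeping `f a ≤ f t`
  -- excludes the last part of the interval.
  have key : ∃ t ∈ Icc a (a + T), m - 1 < f t ∧ f a ≤ f t := by
    by_cases h : m - 1 < f a
    · exact ⟨a, haT, h, le_rfl⟩
    · obtain ⟨_, ⟨t, ht, rfl⟩, h2⟩ :=
        exists_lt_of_lt_csSup (Set.Nonempty.image f ⟨a, haT⟩) (show m - 1 < m by linarith)
      exact ⟨t, ht, h2, by linarith⟩
  obtain ⟨t, ht, h1, h2⟩ := key
  have htS : t < a + T - S := by
    by_contra hcon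
    exact absurd (hlast t ⟨not_lt.1 hcon, ht.2⟩) (not_lt.2 h2)
  refine ⟨t, ht.1, fun s hs => ?_⟩
  have : f (t + s) ≤ m :=
    le_csSup hbdd ⟨t + s, ⟨by linarith [ht.1, hs.1], by linarith [hs.2]⟩, rfl⟩
  linarith

/-- Scales along which the increments of `H` realise every exponent above the lower one. -/
lemma exists_scales {H : ℝ → ℝ}
    (hH : ∀ a ∈ Ioo (0 : ℝ) 1, ∃ D, ∀ r > 0, ∀ l ∈ Icc a 1, |H r - H (l * r)| ≤ D) {δ : ℝ}
    (hδ : tangLiminf (fun l r => H r - H (l * r)) < δ) :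
    ∃ r : ℕ → ℝ, (∀ k, 0 < r k) ∧ Antitone r ∧ Tendsto r atTop (𝓝 0) ∧
      ∀ l ∈ Ioo (0 : ℝ) 1, ∀ᶠ k in atTop, H (r k) - H (l * r k) ≤ δ * Real.log (1 / l) + 1 := by
  obtain ⟨α, hα, hαδ⟩ := EReal.lt_iff_exists_real_btwn.1 hδ
  have hαδ : α < δ := by exact_mod_cast hαδ
  have hfreq := frequently_lt_of_liminf_lt (h := hα)
  -- In logarithmic time `r = exp (-t)`, `l = exp (-s)`, the increment of `H` is `φ (t + s) - φ t`.
  set φ : ℝ → ℝ := fun t => -H (Real.exp (-t)) with hφ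
  have hφb : ∀ S ≥ 0, ∃ D, ∀ t, ∀ s ∈ Icc 0 S, |φ (t + s) - φ t| ≤ D := by
    intro S hS
    obtain ⟨D, hD⟩ := hH (Real.exp (-(S + 1))) ⟨Real.exp_pos _, by
      rw [Real.exp_lt_one_iff]; linarith⟩
    refine ⟨D, fun t s hs => ?_⟩
    have := hD (Real.exp (-t)) (Real.exp_pos _) (Real.exp (-s))
      ⟨Real.exp_le_exp.2 (by linarith [hs.2]), Real.exp_le_one_iff.2 (by linarith [hs.1])⟩
    rw [← Real.exp_add] at this
    simp only [hφ]
    rw [show -(t + s) = -s + -t by ring]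
    convert this using 2
    ring
  -- Some interval `[a, a + T]` has mean slope of `φ` below `α < δ`. Starting from a near-maximum of
  -- `φ t - δ t` on it, `φ` gains at most `δ s + 1` over the next `k` units, provided these stay
  -- inside the interval.
  have main : ∀ k : ℕ, ∃ t : ℝ, (k : ℝ) ≤ t ∧
      ∀ s ∈ Icc (0 : ℝ) k, φ (t + s) - φ t ≤ δ * s + 1 := by
    intro k
    obtain ⟨D, hD⟩ := hφb k (Nat.cast_nonneg k)
    -- `T` is taken so long that the drop `(δ - α) T` of `φ t - δ t` outweighs its variation over
    -- the last `k` units; the extra `k` also gives `k ≤ T`.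
    have hev := tendsto_log_one_div.eventually_ge_atTop
      (k + (D + |δ| * k + 1) / (δ - α))
    obtain ⟨l, hl, hl1, hlT⟩ := (hfreq.and_eventually (eventually_lt_one.and hev)).exists
    have hfreq2 := frequently_lt_of_liminf_lt (h := hl)
    have hev2 := tendsto_log_one_div.eventually_ge_atTop (k : ℝ)
    obtain ⟨r, hr, hr0, hrk⟩ := (hfreq2.and_eventually
      ((eventually_mem_nhdsWithin (a := (0 : ℝ)) (s := Ioi 0)).and hev2)).exists
    have hr0 : 0 < r := hr0
    set T := Real.log (1 / l) with hT
    set a := Real.log (1 / r) with ha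
    have hD0 : 0 ≤ D := le_trans (abs_nonneg _) (hD 0 0 ⟨le_rfl, Nat.cast_nonneg k⟩)
    have hk0 : (0 : ℝ) ≤ k := Nat.cast_nonneg k
    have hdiv : 0 ≤ (D + |δ| * k + 1) / (δ - α) := by
      apply div_nonneg _ (sub_pos.2 hαδ).le
      positivity
    have hT0 : 0 < T := log_one_div_pos hl1
    rw [EReal.coe_lt_coe_iff, div_lt_iff₀ hT0] at hr
    have hera : Real.exp (-a) = r := by rw [ha, one_div, Real.log_inv, neg_neg, Real.exp_log hr0]
    have hela : Real.exp (-T) = l := by rw [hT, one_div, Real.log_inv, neg_neg, Real.exp_log hl1.1]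
    have hend : φ (a + T) - φ a < α * T := by
      simp only [hφ]
      rw [show -(a + T) = -T + -a by ring, Real.exp_add, hera, hela]
      linarith
    have hTbig : D + |δ| * k + 1 ≤ (δ - α) * (T - k) := by
      rw [← div_le_iff₀' (sub_pos.2 hαδ)]
      linarith
    obtain ⟨D', hD'⟩ := hφb T hT0.le
    obtain ⟨t, hta, ht⟩ := exists_near_max (f := fun t => φ t - δ * t) (a := a) (T := T) (S := k)
      (B := φ a + D' + |δ| * (|a| + T)) hk0 (by linarith)
      (by
        intro t ht
        have h1 := hD' a (t - a) ⟨by linarith [ht.1], by linarith [ht.2]⟩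
        rw [add_sub_cancel] at h1
        have h2 : -(δ * t) ≤ |δ| * (|a| + T) := by
          refine le_trans (neg_le_abs _) ?_
          rw [abs_mul]
          gcongr
          rw [abs_le]
          constructor <;> linarith [ht.1, ht.2, neg_abs_le a, le_abs_self a, abs_nonneg a]
        linarith [(abs_le.1 h1).2])
      (by
        intro t ht
        have h1 := hD t (a + T - t) ⟨by linarith [ht.2], by linarith [ht.1]⟩
        rw [add_sub_cancel] at h1
        have h2 : δ * (a + T - t) ≤ |δ| * k := by
          refine le_trans (le_abs_self _) ?_
          rw [abs_mul]
          gcongr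
          rw [abs_le]
          constructor <;> linarith [ht.1, ht.2]
        have h3 : 0 ≤ (δ - α) * k := mul_nonneg (by linarith) hk0
        nlinarith [(abs_le.1 h1).1])
    refine ⟨t, hrk.trans hta, fun s hs => ?_⟩
    have := ht s hs
    linarith
  choose t htk ht using main
  have htt : Tendsto t atTop atTop :=
    tendsto_atTop_mono htk tendsto_natCast_atTop_atTop
  -- Tangent measures are defined along decreasing scales, hence a monotone subsequence.
  obtain ⟨ψ, hψ, hψt⟩ := strictMono_subseq_of_tendsto_atTop htt
  refine ⟨fun k => Real.exp (-t (ψ k)), fun k => Real.exp_pos _, ?_, ?_, ?_⟩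
  · intro i j hij
    exact Real.exp_le_exp.2 (neg_le_neg (hψt.monotone hij))
  · exact Real.tendsto_exp_neg_atTop_nhds_zero.comp (htt.comp hψ.tendsto_atTop)
  · intro l hl
    have hs := log_one_div_pos hl
    have hela : Real.exp (-Real.log (1 / l)) = l := by
      rw [one_div, Real.log_inv, neg_neg, Real.exp_log hl.1]
    filter_upwards [(tendsto_natCast_atTop_atTop.comp hψ.tendsto_atTop).eventually_ge_atTop
      (Real.log (1 / l))] with k hk
    have := ht (ψ k) (Real.log (1 / l)) ⟨hs.le, hk⟩
    simp only [hφ] at this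
    rw [neg_add, Real.exp_add, hela, mul_comm (Real.exp _)] at this
    linarith

/-! ### Covering numbers and separated sets -/

section Cover

variable {M : Type*} [MetricSpace M]

/-- If no such cover existed, a separated set could always be enlarged by an uncovered point, past
the cardinality `K`. -/
lemma exists_cover_of_card_le {S : Set M} {ρ K : ℝ} (hρ : 0 < ρ)
    (h : ∀ t : Finset M, (t : Set M) ⊆ S → (∀ y ∈ t, ∀ z ∈ t, y ≠ z → ρ ≤ dist y z) →
      (t.card : ℝ) ≤ K) :
    ∃ t : Finset M, S ⊆ (⋃ y ∈ (t : Set M), Metric.ball y ρ) ∧ (t.card : ℝ) ≤ K := by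
  classical
  by_contra! hcon
  have step : ∀ n : ℕ, ∃ t : Finset M, t.card = n ∧ (t : Set M) ⊆ S ∧
      ∀ y ∈ t, ∀ z ∈ t, y ≠ z → ρ ≤ dist y z := by
    intro n
    induction n with
    | zero => exact ⟨∅, by simp⟩
    | succ n ih =>
      obtain ⟨t, htn, htS, ht⟩ := ih
      have : ¬ S ⊆ ⋃ y ∈ (t : Set M), Metric.ball y ρ := fun hc =>
        absurd (hcon t hc) (not_lt.2 (h t htS ht))
      obtain ⟨a, haS, hat⟩ := not_subset.1 this
      have hat : ∀ y ∈ t, ρ ≤ dist a y := by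
        intro y hy
        by_contra hc
        exact hat (mem_biUnion (Finset.mem_coe.2 hy) (Metric.mem_ball.2 (not_le.1 hc)))
      have hnot : a ∉ t := fun hc => by
        have := hat a hc
        rw [dist_self] at this
        linarith
      refine ⟨insert a t, by rw [Finset.card_insert_of_notMem hnot, htn], ?_, ?_⟩
      · rw [Finset.coe_insert]
        exact insert_subset haS htS
      · intro y hy z hz hyz
        rcases Finset.mem_insert.1 hy with rfl | hy' <;> rcases Finset.mem_insert.1 hz with rfl | hz'
        · exact absurd rfl hyz
        · exact hat z hz'
        · rw [dist_comm]
          exact hat y hy'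
        · exact ht y hy' z hz' hyz
  obtain ⟨n, hn⟩ := exists_nat_gt K
  obtain ⟨t, htn, htS, ht⟩ := step n
  have := h t htS ht
  rw [htn] at this
  linarith

lemma exists_coverNumber_eq {S : Set M} {ρ K k : ℝ}
    (h₁ : ∃ t : Finset M, S ⊆ (⋃ y ∈ (t : Set M), Metric.ball y ρ) ∧ (t.card : ℝ) ≤ K)
    (h₂ : ∀ t : Finset M, S ⊆ (⋃ y ∈ (t : Set M), Metric.ball y ρ) → k ≤ t.card) :
    ∃ n : ℕ, coverNumber ρ S = n ∧ k ≤ n ∧ n ≤ K := by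
  obtain ⟨t, ht, htK⟩ := h₁
  have hup : coverNumber ρ S ≤ t.card := by
    rw [← Set.encard_coe_eq_coe_finsetCard]
    exact iInf₂_le (t : Set M) ht
  have hlow : ((⌈k⌉₊ : ℕ) : ℕ∞) ≤ coverNumber ρ S := by
    refine le_iInf₂ fun C hC => ?_
    by_cases hfin : C.Finite
    · rw [← hfin.coe_toFinset, Set.encard_coe_eq_coe_finsetCard]
      exact_mod_cast Nat.ceil_le.2 (h₂ hfin.toFinset (by rwa [hfin.coe_toFinset]))
    · rw [Set.Infinite.encard_eq hfin]
      exact le_top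
  obtain ⟨n, hn⟩ := ENat.ne_top_iff_exists.1 (ne_top_of_le_ne_top (ENat.natCast_ne_top _) hup)
  rw [← hn] at hup hlow
  refine ⟨n, hn.symm, Nat.ceil_le.1 (by exact_mod_cast hlow), le_trans ?_ htK⟩
  exact_mod_cast hup

end Cover

lemma abs_log_sub_le {n a b K : ℝ} (hn : 0 < n) (ha : 0 < a) (hb : 0 < b) (hK : 0 < K)
    (h₁ : n * b ≤ K * a) (h₂ : a ≤ n * (K * b)) :
    |Real.log n - (Real.log a - Real.log b)| ≤ Real.log K := by
  have e₁ := Real.log_le_log (by positivity) h₁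
  have e₂ := Real.log_le_log ha h₂
  rw [Real.log_mul hn.ne' hb.ne', Real.log_mul hK.ne' ha.ne'] at e₁
  rw [Real.log_mul hn.ne' (by positivity), Real.log_mul hK.ne' hb.ne'] at e₂
  rw [abs_le]
  constructor <;> linarith

/-! ### Measures with uniformly comparable and doubling balls -/

/-- A probability measure carried by `F` for which any two balls with centers in `F` and
comparable radii have comparable measures. -/
structure UniformBalls {M : Type*} [MetricSpace M] [MeasurableSpace M] (F : Set M)
    (μ : Measure M) (A : ℝ) : Prop where
  isProbabilityMeasure : IsProbabilityMeasure μ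
  compl : μ Fᶜ = 0
  doubling : ∀ y ∈ F, ∀ z ∈ F, ∀ r > 0,
    μ.real (Metric.ball y (2 * r)) ≤ A * μ.real (Metric.ball z r)

namespace UniformBalls

variable {M : Type*} [MetricSpace M] [MeasurableSpace M] {F : Set M} {μ : Measure M} {A : ℝ}

/-- Doubling would spread a null ball to all balls of radius `2 ^ n * r`, which exhaust the space.
-/
lemma pos (hU : UniformBalls F μ A) {z : M} (hz : z ∈ F) {r : ℝ} (hr : 0 < r) :
    0 < μ.real (Metric.ball z r) := by
  have := hU.isProbabilityMeasure
  by_contra hcon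
  have h0 : μ.real (Metric.ball z r) = 0 := le_antisymm (not_lt.1 hcon) measureReal_nonneg
  have hind : ∀ n : ℕ, μ (Metric.ball z (2 ^ n * r)) = 0 := by
    intro n
    rw [← measureReal_eq_zero_iff]
    induction n with
    | zero => simpa using h0
    | succ n ih =>
      have := hU.doubling z hz z hz (2 ^ n * r) (by positivity)
      rw [ih, mul_zero, ← mul_assoc, ← pow_succ'] at this
      exact le_antisymm this measureReal_nonneg
  have huniv : (⋃ n : ℕ, Metric.ball z (2 ^ n * r)) = univ := by
    refine eq_univ_of_forall fun y => ?_
    obtain ⟨n, hn⟩ := pow_unbounded_of_one_lt (dist y z / r) one_lt_two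
    exact mem_iUnion.2 ⟨n, Metric.mem_ball.2 ((div_lt_iff₀ hr).1 hn)⟩
  have : μ univ = 0 := by
    rw [← huniv]
    exact measure_iUnion_null hind
  simp at this

lemma real_mono (hU : UniformBalls F μ A) (x : M) : Monotone fun r => μ.real (Metric.ball x r) := by
  have := hU.isProbabilityMeasure
  exact fun r s hrs => measureReal_mono (Metric.ball_subset_ball hrs)

lemma one_le (hU : UniformBalls F μ A) {x : M} (hx : x ∈ F) : 1 ≤ A := by
  have h1 := hU.doubling x hx x hx 1 one_pos
  have h2 := hU.real_mono x (show (1 : ℝ) ≤ 2 * 1 by norm_num)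
  have h3 := hU.pos hx one_pos
  exact le_of_mul_le_mul_right (by simpa using h2.trans h1) h3

lemma le_mul (hU : UniformBalls F μ A) {y z : M} (hy : y ∈ F) (hz : z ∈ F) {r : ℝ} (hr : 0 < r) :
    μ.real (Metric.ball y r) ≤ A * μ.real (Metric.ball z r) :=
  (hU.real_mono y (by linarith)).trans (hU.doubling y hy z hz r hr)

lemma le_pow_mul (hU : UniformBalls F μ A) {x : M} (hx : x ∈ F) (n : ℕ) {r : ℝ} (hr : 0 < r) :
    μ.real (Metric.ball x (2 ^ n * r)) ≤ A ^ n * μ.real (Metric.ball x r) := by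
  have hA := hU.one_le hx
  induction n with
  | zero => simp
  | succ n ih =>
    have := hU.doubling x hx x hx (2 ^ n * r) (by positivity)
    rw [pow_succ', mul_assoc, pow_succ', mul_assoc]
    exact this.trans (mul_le_mul_of_nonneg_left ih (by linarith))

/-- The increment of `log μ(B(x,·))` between the radii `l * r` and `r`. -/
def incr (μ : Measure M) (x : M) (l r : ℝ) : ℝ :=
  Real.log (μ.real (Metric.ball x r)) - Real.log (μ.real (Metric.ball x (l * r)))

/-- The upper end `b` is free because the bound is also needed for factors `l > 1`. -/
lemma exists_abs_incr_le (hU : UniformBalls F μ A) {x : M} (hx : x ∈ F) {a : ℝ} (ha : 0 < a)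
    (b : ℝ) : ∃ D, ∀ r > 0, ∀ l ∈ Icc a b, |incr μ x l r| ≤ D := by
  have hA := hU.one_le hx
  obtain ⟨n, hn⟩ := pow_unbounded_of_one_lt (max b a⁻¹) one_lt_two
  refine ⟨Real.log (A ^ n), fun r hr l hl => ?_⟩
  have hl0 : 0 < l := ha.trans_le hl.1
  have hAn : 0 < A ^ n := by positivity
  have h1 : μ.real (Metric.ball x (l * r)) ≤ A ^ n * μ.real (Metric.ball x r) := by
    refine le_trans (hU.real_mono x ?_) (hU.le_pow_mul hx n hr)
    have : l ≤ 2 ^ n := hl.2.trans ((le_max_left _ _).trans hn.le)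
    gcongr
  have h2 : μ.real (Metric.ball x r) ≤ A ^ n * μ.real (Metric.ball x (l * r)) := by
    refine le_trans (hU.real_mono x ?_) (hU.le_pow_mul hx n (mul_pos hl0 hr))
    have : l⁻¹ ≤ 2 ^ n := (inv_anti₀ ha hl.1).trans ((le_max_right _ _).trans hn.le)
    rw [← mul_assoc]
    refine le_mul_of_one_le_left hr.le ?_
    rwa [inv_le_iff_one_le_mul₀ hl0] at this
  have p1 := hU.pos hx hr
  have p2 := hU.pos hx (mul_pos hl0 hr)
  have e1 := Real.log_le_log p2 h1
  have e2 := Real.log_le_log p1 h2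
  rw [Real.log_mul hAn.ne' p1.ne'] at e1
  rw [Real.log_mul hAn.ne' p2.ne'] at e2
  rw [incr, abs_le]
  constructor <;> linarith

lemma locallyComparableBalls (hU : UniformBalls F μ A) : LocallyComparableBalls F μ := by
  have := hU.isProbabilityMeasure
  intro x hx
  have hA := hU.one_le hx
  have hA0 : 0 < A.toNNReal := Real.toNNReal_pos.2 (by linarith)
  have conv : ∀ y ∈ F, ∀ z ∈ F, ∀ r > 0,
      μ (Metric.ball y r ∩ F) ≤ (A.toNNReal : ℝ≥0∞) * μ (Metric.ball z r ∩ F) := by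
    intro y hy z hz r hr
    have hnull : ∀ w, μ (Metric.ball w r ∩ F) = μ (Metric.ball w r) := fun w =>
      measure_inter_conull hU.compl
    rw [hnull, hnull, ← ofReal_measureReal, ← ofReal_measureReal]
    change _ ≤ ENNReal.ofReal A * _
    rw [← ENNReal.ofReal_mul (by linarith)]
    exact ENNReal.ofReal_le_ofReal (hU.le_mul hy hz hr)
  refine ⟨1, A.toNNReal, one_pos, hA0, fun y hy r hr => ⟨?_, conv y hy.2 x hx r hr.1⟩⟩
  rw [ENNReal.inv_mul_le_iff (by simpa using hA0.ne') ENNReal.coe_ne_top]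
  exact conv x hx y hy.2 r hr.1

/-- Packing: the balls of radius `r / 2` about the points are disjoint, lie in `B(x, 2R)`, and each
has at least `1 / A` of the mass of `B(x, r)`. -/
lemma card_mul_le [OpensMeasurableSpace M] (hU : UniformBalls F μ A) {x : M} (hx : x ∈ F)
    {r R : ℝ} (hr : 0 < r) (hrR : r ≤ 2 * R) {t : Finset M}
    (htF : (t : Set M) ⊆ F ∩ Metric.ball x R)
    (ht : ∀ y ∈ t, ∀ z ∈ t, y ≠ z → r ≤ dist y z) :
    t.card * μ.real (Metric.ball x r) ≤ A ^ 2 * μ.real (Metric.ball x R) := by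
  have := hU.isProbabilityMeasure
  have hA := hU.one_le hx
  have h1 : ∀ y ∈ t, μ.real (Metric.ball x r) ≤ A * μ.real (Metric.ball y (r / 2)) := by
    intro y hy
    have := hU.doubling x hx y (htF hy).1 (r / 2) (by positivity)
    rwa [mul_div_cancel₀ _ two_ne_zero] at this
  have hdisj : (t : Set M).PairwiseDisjoint fun y => Metric.ball y (r / 2) := by
    intro y hy z hz hyz
    exact Metric.ball_disjoint_ball (by linarith [ht y hy z hz hyz])
  have hsub : (⋃ y ∈ t, Metric.ball y (r / 2)) ⊆ Metric.ball x (2 * R) := by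
    refine iUnion₂_subset fun y hy => Metric.ball_subset_ball' ?_
    have := Metric.mem_ball.1 (htF hy).2
    linarith
  have h2 : ∑ y ∈ t, μ.real (Metric.ball y (r / 2)) ≤ μ.real (Metric.ball x (2 * R)) := by
    rw [← measureReal_biUnion_finset hdisj (fun _ _ => measurableSet_ball)]
    exact measureReal_mono hsub
  calc t.card * μ.real (Metric.ball x r) = ∑ y ∈ t, μ.real (Metric.ball x r) := by simp
    _ ≤ ∑ y ∈ t, A * μ.real (Metric.ball y (r / 2)) := Finset.sum_le_sum h1
    _ = A * ∑ y ∈ t, μ.real (Metric.ball y (r / 2)) := by rw [Finset.mul_sum]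
    _ ≤ A * (A * μ.real (Metric.ball x R)) := by
        have := h2.trans (hU.doubling x hx x hx R (by linarith))
        gcongr
    _ = _ := by ring

/-- The part of `S i` in `F` lies in the ball of radius `2r` about any of its points. General sets
are allowed so that preimages of balls of a tangent set can be used. -/
lemma le_card_mul (hU : UniformBalls F μ A) {x : M} (hx : x ∈ F) {r R : ℝ} (hr : 0 < r)
    {ι : Type*} {t : Finset ι} {S : ι → Set M} (hcov : F ∩ Metric.ball x R ⊆ ⋃ i ∈ t, S i)
    (hS : ∀ i ∈ t, ∀ y ∈ S i ∩ F, ∀ z ∈ S i ∩ F, dist y z < 2 * r) :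
    μ.real (Metric.ball x R) ≤ t.card * (A * μ.real (Metric.ball x r)) := by
  have := hU.isProbabilityMeasure
  have hA := hU.one_le hx
  have hcov' : Metric.ball x R ∩ F ⊆ ⋃ i ∈ t, S i ∩ F := by
    intro y hy
    obtain ⟨i, hi, hyi⟩ := mem_iUnion₂.1 (hcov ⟨hy.2, hy.1⟩)
    exact mem_iUnion₂.2 ⟨i, hi, hyi, hy.2⟩
  have h1 : ∀ i ∈ t, μ.real (S i ∩ F) ≤ A * μ.real (Metric.ball x r) := by
    intro i hi
    rcases (S i ∩ F).eq_empty_or_nonempty with he | ⟨y, hy⟩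
    · rw [he, measureReal_empty]
      positivity
    · refine (measureReal_mono ?_).trans (hU.doubling y hy.2 x hx r hr)
      exact fun z hz => hS i hi z hz y hy
  calc μ.real (Metric.ball x R) = μ.real (Metric.ball x R ∩ F) := by
        rw [measureReal_def, measureReal_def, measure_inter_conull hU.compl]
    _ ≤ μ.real (⋃ i ∈ t, S i ∩ F) := measureReal_mono hcov' (measure_ne_top _ _)
    _ ≤ ∑ i ∈ t, μ.real (S i ∩ F) := measureReal_biUnion_finset_le _ _
    _ ≤ ∑ i ∈ t, A * μ.real (Metric.ball x r) := Finset.sum_le_sum h1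
    _ = _ := by simp

/-! ### Tangential dimensions of a set and of a measure -/

lemma log_ratio (hU : UniformBalls F μ A) {x : M} (hx : x ∈ F) {l r : ℝ} (hl : 0 < l)
    (hr : 0 < r) :
    ENNReal.log (μ (Metric.ball x r) / μ (Metric.ball x (l * r))) = (incr μ x l r : ℝ) := by
  have := hU.isProbabilityMeasure
  have p1 := hU.pos hx hr
  have p2 := hU.pos hx (mul_pos hl hr)
  rw [← ofReal_measureReal, ← ofReal_measureReal, ← ENNReal.ofReal_div_of_pos p2,
    ENNReal.log_ofReal_of_pos (by positivity), Real.log_div p1.ne' p2.ne', incr]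

lemma lowerTangDim_eq (hU : UniformBalls F μ A) {x : M} (hx : x ∈ F) :
    lowerTangDim μ x = tangLiminf (incr μ x) := by
  refine liminf_congr ?_
  filter_upwards [self_mem_nhdsWithin] with l hl
  refine liminf_congr ?_
  filter_upwards [self_mem_nhdsWithin] with r hr
  rw [hU.log_ratio hx hl hr, EReal.coe_div]

lemma upperTangDim_eq (hU : UniformBalls F μ A) {x : M} (hx : x ∈ F) :
    upperTangDim μ x = tangLimsup (incr μ x) := by
  refine limsup_congr ?_
  filter_upwards [self_mem_nhdsWithin] with l hl
  refine limsup_congr ?_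
  filter_upwards [self_mem_nhdsWithin] with r hr
  rw [hU.log_ratio hx hl hr, EReal.coe_div]

lemma log_coverNumber [OpensMeasurableSpace M] (hU : UniformBalls F μ A) {x : M} (hx : x ∈ F)
    {l r : ℝ} (hl : l ∈ Ioo (0 : ℝ) 1) (hr : 0 < r) :
    ∃ c : ℝ, ENNReal.log (coverNumber (l * r) (F ∩ Metric.closedBall x r) : ℝ≥0∞) = (c : ℝ) ∧
      |c - incr μ x l r| ≤ Real.log (A ^ 3) := by
  have hA := hU.one_le hx
  have hlr : 0 < l * r := mul_pos hl.1 hr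
  have p1 := hU.pos hx hr
  have p2 := hU.pos hx hlr
  have hlr1 : l * r ≤ r := mul_le_of_le_one_left hr.le hl.2.le
  obtain ⟨n, hn, hn1, hn2⟩ := exists_coverNumber_eq (S := F ∩ Metric.closedBall x r) (ρ := l * r)
    (k := μ.real (Metric.ball x r) / (A * μ.real (Metric.ball x (l * r))))
    (exists_cover_of_card_le hlr
      (K := A ^ 3 * μ.real (Metric.ball x r) / μ.real (Metric.ball x (l * r))) (by
        intro t htS ht
        rw [le_div_iff₀ p2]
        -- The closed ball is put into an open ball of radius `2r`, which costs the third factor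
        -- `A`.
        refine (hU.card_mul_le hx (R := 2 * r) hlr (by linarith) ?_ ht).trans ?_
        · intro y hy
          exact ⟨(htS hy).1, Metric.closedBall_subset_ball (by linarith) (htS hy).2⟩
        · have := hU.doubling x hx x hx r hr
          calc _ ≤ A ^ 2 * (A * μ.real (Metric.ball x r)) := by gcongr
            _ = _ := by ring))
    (by
      intro t ht
      rw [div_le_iff₀ (by positivity)]
      refine hU.le_card_mul hx hlr (S := fun y => Metric.ball y (l * r)) ?_ ?_
      · intro y hy
        simpa using ht ⟨hy.1, Metric.ball_subset_closedBall hy.2⟩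
      · intro i _ y hy z hz
        have h1 := Metric.mem_ball.1 hy.1
        have h2 := Metric.mem_ball'.1 hz.1
        linarith [dist_triangle y i z])
  rw [div_le_iff₀ (by positivity)] at hn1
  rw [le_div_iff₀ p2] at hn2
  have hn0 : (0 : ℝ) < n := by
    by_contra hc
    have : (n : ℝ) = 0 := le_antisymm (not_lt.1 hc) (Nat.cast_nonneg n)
    rw [this] at hn1
    linarith
  refine ⟨Real.log n, ?_, abs_log_sub_le hn0 p1 p2 (by positivity) hn2 (hn1.trans ?_)⟩
  · rw [hn, ← ENNReal.log_ofReal_of_pos hn0]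
    simp
  · have : A ≤ A ^ 3 := le_self_pow₀ hA (by norm_num)
    gcongr

lemma exists_logCover [OpensMeasurableSpace M] (hU : UniformBalls F μ A) {x : M} (hx : x ∈ F) :
    ∃ c : ℝ → ℝ → ℝ, ∀ l ∈ Ioo (0 : ℝ) 1, ∀ r > 0,
      ENNReal.log (coverNumber (l * r) (F ∩ Metric.closedBall x r) : ℝ≥0∞) = (c l r : ℝ) ∧
        |c l r - incr μ x l r| ≤ Real.log (A ^ 3) := by
  classical
  have h : ∀ l r : ℝ, ∃ c : ℝ, l ∈ Ioo (0 : ℝ) 1 → 0 < r →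
      ENNReal.log (coverNumber (l * r) (F ∩ Metric.closedBall x r) : ℝ≥0∞) = (c : ℝ) ∧
        |c - incr μ x l r| ≤ Real.log (A ^ 3) := by
    intro l r
    by_cases h : l ∈ Ioo (0 : ℝ) 1 ∧ 0 < r
    · obtain ⟨c, hc⟩ := hU.log_coverNumber hx h.1 h.2
      exact ⟨c, fun _ _ => hc⟩
    · exact ⟨0, fun h1 h2 => absurd ⟨h1, h2⟩ h⟩
  choose c hc using h
  exact ⟨c, fun l hl r hr => hc l r hl hr⟩

lemma lowerTangDimSet_eq [OpensMeasurableSpace M] (hU : UniformBalls F μ A) {x : M}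
    (hx : x ∈ F) : lowerTangDimSet F x = tangLiminf (incr μ x) := by
  obtain ⟨c, hc⟩ := hU.exists_logCover hx
  have : lowerTangDimSet F x = tangLiminf c := by
    refine liminf_congr ?_
    filter_upwards [eventually_lt_one] with l hl
    refine liminf_congr ?_
    filter_upwards [self_mem_nhdsWithin] with r hr
    rw [(hc l hl r hr).1, EReal.coe_div]
  rw [this]
  exact le_antisymm
    (tangLiminf_le_of_le_add fun l hl r hr => by
      have := (abs_le.1 (hc l hl r hr).2).2
      exact sub_le_iff_le_add'.1 this)
    (tangLiminf_le_of_le_add (C := Real.log (A ^ 3)) fun l hl r hr => by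
      linarith [(abs_le.1 (hc l hl r hr).2).1])

lemma upperTangDimSet_eq [OpensMeasurableSpace M] (hU : UniformBalls F μ A) {x : M}
    (hx : x ∈ F) : upperTangDimSet F x = tangLimsup (incr μ x) := by
  obtain ⟨c, hc⟩ := hU.exists_logCover hx
  have : upperTangDimSet F x = tangLimsup c := by
    refine limsup_congr ?_
    filter_upwards [eventually_lt_one] with l hl
    refine limsup_congr ?_
    filter_upwards [self_mem_nhdsWithin] with r hr
    rw [(hc l hl r hr).1, EReal.coe_div]
  rw [this]
  exact le_antisymm
    (tangLimsup_le_of_le_add (C := Real.log (A ^ 3)) fun l hl r hr => by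
      linarith [(abs_le.1 (hc l hl r hr).2).2])
    (tangLimsup_le_of_le_add (C := Real.log (A ^ 3)) fun l hl r hr => by
      linarith [(abs_le.1 (hc l hl r hr).2).1])

/-! ### Local dimensions of tangent sets -/

/-- The almost isometries carry separated subsets of the tangent ball back to `F`, and pull covers
of it back to covers of a piece of `F`. Packing and covering in `F` then bound one number, which is
independent of `k`, for all large `k`. -/
lemma eventually_log_coverNumber_tangent [OpensMeasurableSpace M] (hU : UniformBalls F μ A)
    {x : M} (hx : x ∈ F) {s : ℕ → ℝ} (hs : Tendsto s atTop atTop) {T : PointedProperSpace}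
    (hT : PointedGHTendsto F x s T) {ρ R : ℝ} (hρ : 0 < ρ) (hρR : ρ < R) :
    ∃ c : ℝ, ENNReal.log (coverNumber ρ (Metric.ball T.base R) : ℝ≥0∞) = (c : ℝ) ∧
      ∀ᶠ k in atTop, |c - (Real.log (μ.real (Metric.ball x (R * (s k)⁻¹))) -
        Real.log (μ.real (Metric.ball x (ρ * (s k)⁻¹))))| ≤ Real.log (A ^ 5) := by
  classical
  have hA := hU.one_le hx
  have hR : 0 < R := hρ.trans hρR
  -- Since `3R - ρ/8 > R`, all of `B(o, R)` is approximated. Three errors of `ρ/8` turn a separation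
  -- `ρ` into more than `ρ/2`.
  have hev := (hT (3 * R) (by positivity) (ρ / 8) (by positivity)).and (hs.eventually_gt_atTop 0)
  have main : ∀ k, (∃ f : M → T.carrier,
    f x = T.base ∧
    (∀ y ∈ F, ∀ z ∈ F, s k * dist y x < 3 * R → s k * dist z x < 3 * R →
      |dist (f y) (f z) - s k * dist y z| < ρ / 8) ∧
    (∀ t : T.carrier, dist t T.base < 3 * R - ρ / 8 →
      ∃ y ∈ F, s k * dist y x < 3 * R ∧ dist t (f y) < ρ / 8)) ∧ 0 < s k →
      ∃ n : ℕ, coverNumber ρ (Metric.ball T.base R) = n ∧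
        μ.real (Metric.ball x (R * (s k)⁻¹)) / (A ^ 3 * μ.real (Metric.ball x (ρ * (s k)⁻¹))) ≤ n ∧
        n ≤ A ^ 5 * μ.real (Metric.ball x (R * (s k)⁻¹)) /
          μ.real (Metric.ball x (ρ * (s k)⁻¹)) := by
    rintro k ⟨⟨f, hfx, hf, hfs⟩, hsk⟩
    set σ := (s k)⁻¹ with hσ
    have hσ0 : 0 < σ := inv_pos.2 hsk
    have hlt : ∀ {d a : ℝ}, s k * d < a ↔ d < a * σ := by
      intro d a
      rw [hσ, ← div_eq_mul_inv, lt_div_iff₀' hsk]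
    have p2 := hU.pos hx (mul_pos hρ hσ0)
    refine exists_coverNumber_eq (exists_cover_of_card_le hρ ?_) ?_
    · intro t htS ht
      rw [le_div_iff₀ p2]
      have hch : ∀ a : T.carrier, ∃ y : M, a ∈ t →
          y ∈ F ∧ s k * dist y x < 3 * R ∧ dist a (f y) < ρ / 8 := by
        intro a
        by_cases ha : a ∈ t
        · have := Metric.mem_ball.1 (htS ha)
          obtain ⟨y, hy⟩ := hfs a (by linarith)
          exact ⟨y, fun _ => hy⟩
        · exact ⟨x, fun h => absurd h ha⟩
      choose y hy using hch
      have hsep : ∀ a ∈ t, ∀ b ∈ t, a ≠ b → ρ / 2 * σ ≤ dist (y a) (y b) := by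
        intro a ha b hb hab
        by_contra hc
        have hc := hlt.2 (not_le.1 hc)
        have h1 := (abs_lt.1 (hf _ (hy a ha).1 _ (hy b hb).1 (hy a ha).2.1 (hy b hb).2.1)).2
        have h2 := ht a ha b hb hab
        have h3 := (hy a ha).2.2
        have h4 := (hy b hb).2.2
        rw [dist_comm] at h4
        linarith [dist_triangle4 a (f (y a)) (f (y b)) b]
      have hinj : Set.InjOn y t := by
        intro a ha b hb hab
        by_contra hne
        have := hsep a ha b hb hne
        rw [hab, dist_self] at this
        have : 0 < ρ / 2 * σ := by positivity
        linarith
      have hcard := hU.card_mul_le hx (r := ρ / 2 * σ) (R := 3 * R * σ) (t := t.image y)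
        (by positivity)
        (by
          rw [← mul_assoc]
          gcongr
          linarith)
        (by
          intro z hz
          obtain ⟨a, ha, rfl⟩ := Finset.mem_image.1 (Finset.mem_coe.1 hz)
          exact ⟨(hy a ha).1, hlt.1 (hy a ha).2.1⟩)
        (by
          intro z hz w hw hzw
          obtain ⟨a, ha, rfl⟩ := Finset.mem_image.1 hz
          obtain ⟨b, hb, rfl⟩ := Finset.mem_image.1 hw
          exact hsep a ha b hb fun h => hzw (by rw [h]))
      rw [Finset.card_image_of_injOn hinj] at hcard
      have h1 : μ.real (Metric.ball x (ρ * σ)) ≤ A * μ.real (Metric.ball x (ρ / 2 * σ)) := by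
        have := hU.doubling x hx x hx (ρ / 2 * σ) (by positivity)
        rwa [← mul_assoc, mul_div_cancel₀ _ two_ne_zero] at this
      have h2 : μ.real (Metric.ball x (3 * R * σ)) ≤ A ^ 2 * μ.real (Metric.ball x (R * σ)) := by
        refine le_trans (hU.real_mono x ?_) (hU.le_pow_mul hx 2 (by positivity))
        nlinarith [mul_pos hR hσ0]
      calc t.card * μ.real (Metric.ball x (ρ * σ))
          ≤ t.card * (A * μ.real (Metric.ball x (ρ / 2 * σ))) := by gcongr
        _ = A * (t.card * μ.real (Metric.ball x (ρ / 2 * σ))) := by ring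
        _ ≤ A * (A ^ 2 * (A ^ 2 * μ.real (Metric.ball x (R * σ)))) := by
            have := hcard.trans (mul_le_mul_of_nonneg_left h2 (by positivity))
            gcongr
        _ = _ := by ring
    · intro t ht
      rw [div_le_iff₀ (by positivity)]
      -- Radius `R / 2` leaves room for the distortion, so that `f` maps this piece of `F` into
      -- `B(o, R)`.
      have hcov := hU.le_card_mul hx (r := 2 * ρ * σ) (R := R / 2 * σ) (t := t)
        (S := fun a => {y | y ∈ Metric.ball x (R / 2 * σ) ∧ f y ∈ Metric.ball a ρ})
        (by positivity)
        (by
          intro y hy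
          have hyx : s k * dist y x < R / 2 := hlt.2 hy.2
          have h1 := (abs_lt.1 (hf y hy.1 x hx (by linarith) (by rw [dist_self]; linarith))).2
          rw [hfx] at h1
          have h2 := ht (Metric.mem_ball.2 (show dist (f y) T.base < R by linarith))
          obtain ⟨a, ha, hya⟩ := mem_iUnion₂.1 h2
          exact mem_iUnion₂.2 ⟨a, ha, hy.2, hya⟩)
        (by
          rintro a - y ⟨⟨hyx, hya⟩, hyF⟩ z ⟨⟨hzx, hza⟩, hzF⟩
          have hyx : s k * dist y x < R / 2 := hlt.2 hyx
          have hzx : s k * dist z x < R / 2 := hlt.2 hzx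
          have h1 := (abs_lt.1 (hf y hyF z hzF (by linarith) (by linarith))).1
          have h2 := Metric.mem_ball.1 hya
          have h3 := Metric.mem_ball'.1 hza
          rw [← mul_assoc]
          refine hlt.1 ?_
          linarith [dist_triangle (f y) a (f z)])
      have h1 : μ.real (Metric.ball x (R * σ)) ≤ A * μ.real (Metric.ball x (R / 2 * σ)) := by
        have := hU.doubling x hx x hx (R / 2 * σ) (by positivity)
        rwa [← mul_assoc, mul_div_cancel₀ _ two_ne_zero] at this
      have h2 : μ.real (Metric.ball x (2 * ρ * σ)) ≤ A * μ.real (Metric.ball x (ρ * σ)) := by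
        rw [mul_assoc]
        exact hU.doubling x hx x hx (ρ * σ) (by positivity)
      calc μ.real (Metric.ball x (R * σ)) ≤ A * μ.real (Metric.ball x (R / 2 * σ)) := h1
        _ ≤ A * (t.card * (A * (A * μ.real (Metric.ball x (ρ * σ))))) := by
            have := hcov.trans (mul_le_mul_of_nonneg_left
              (mul_le_mul_of_nonneg_left h2 (by linarith)) (by positivity))
            gcongr
        _ = _ := by ring
  obtain ⟨k₀, hk₀⟩ := hev.exists
  obtain ⟨n, hn, hlow, -⟩ := main k₀ hk₀
  have hn0 : (0 : ℝ) < n := by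
    have hσ0 : 0 < (s k₀)⁻¹ := inv_pos.2 hk₀.2
    have p1 := hU.pos hx (mul_pos hR hσ0)
    have p2 := hU.pos hx (mul_pos hρ hσ0)
    exact lt_of_lt_of_le (by positivity) hlow
  refine ⟨Real.log n, ?_, ?_⟩
  · rw [hn, ← ENNReal.log_ofReal_of_pos hn0]
    simp
  · filter_upwards [hev] with k hk
    obtain ⟨n', hn', hn1, hn2⟩ := main k hk
    have hnn : n' = n := by exact_mod_cast hn'.symm.trans hn
    subst hnn
    have hσ0 : 0 < (s k)⁻¹ := inv_pos.2 hk.2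
    have p1 := hU.pos hx (mul_pos hR hσ0)
    have p2 := hU.pos hx (mul_pos hρ hσ0)
    rw [div_le_iff₀ (by positivity)] at hn1
    rw [le_div_iff₀ p2] at hn2
    refine abs_log_sub_le hn0 p1 p2 (by positivity) hn2 (hn1.trans ?_)
    have : A ^ 3 ≤ A ^ 5 := pow_le_pow_right₀ hA (by norm_num)
    gcongr

/-- The increments supplied start from radius `R`, those wanted from radius `1`; the difference is
bounded by a constant depending on `R` only. -/
lemma exists_growsLike_tangent [OpensMeasurableSpace M] (hU : UniformBalls F μ A)
    {x : M} (hx : x ∈ F) {s : ℕ → ℝ} (hs : Tendsto s atTop atTop) {T : PointedProperSpace}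
    (hT : PointedGHTendsto F x s T) {R : ℝ} (hR : 0 < R) :
    ∃ G : ℝ → ℝ, GrowsLike (incr μ x) (fun k => (s k)⁻¹) G ∧
      liminf (fun r : ℝ => ENNReal.log (coverNumber r (Metric.ball T.base R) : ℝ≥0∞) /
        ((Real.log (1 / r) : ℝ) : EReal)) (𝓝[>] 0) = localLiminf G ∧
      limsup (fun r : ℝ => ENNReal.log (coverNumber r (Metric.ball T.base R) : ℝ≥0∞) /
        ((Real.log (1 / r) : ℝ) : EReal)) (𝓝[>] 0) = localLimsup G := by
  have h : ∀ ρ : ℝ, ∃ c : ℝ, ρ ∈ Ioo 0 R →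
      ENNReal.log (coverNumber ρ (Metric.ball T.base R) : ℝ≥0∞) = (c : ℝ) ∧
      ∀ᶠ k in atTop, |c - (Real.log (μ.real (Metric.ball x (R * (s k)⁻¹))) -
        Real.log (μ.real (Metric.ball x (ρ * (s k)⁻¹))))| ≤ Real.log (A ^ 5) := by
    intro ρ
    by_cases h : ρ ∈ Ioo 0 R
    · obtain ⟨c, hc⟩ := hU.eventually_log_coverNumber_tangent hx hs hT h.1 h.2
      exact ⟨c, fun _ => hc⟩
    · exact ⟨0, fun h' => absurd h' h⟩
  choose G hG using h
  have hmem : ∀ᶠ ρ in 𝓝[>] (0 : ℝ), ρ ∈ Ioo 0 R := Ioo_mem_nhdsGT hR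
  refine ⟨G, ?_, ?_, ?_⟩
  · obtain ⟨D, hD⟩ := hU.exists_abs_incr_le hx hR R
    refine ⟨Real.log (A ^ 5) + D, ?_⟩
    filter_upwards [hmem] with ρ hρ
    filter_upwards [(hG ρ hρ).2, hs.eventually_gt_atTop 0] with k hk hsk
    have h1 := hD (s k)⁻¹ (inv_pos.2 hsk) R ⟨le_rfl, le_rfl⟩
    rw [incr] at h1 ⊢
    rw [abs_le] at hk h1 ⊢
    constructor <;> linarith [hk.1, hk.2, h1.1, h1.2]
  · refine liminf_congr ?_
    filter_upwards [hmem] with ρ hρ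
    rw [(hG ρ hρ).1, EReal.coe_div]
  · refine limsup_congr ?_
    filter_upwards [hmem] with ρ hρ
    rw [(hG ρ hρ).1, EReal.coe_div]

end UniformBalls

/-! ### Vague compactness of measures of polynomial growth -/

section Vague

variable {M : Type*} [MetricSpace M] [MeasurableSpace M]

/-- Trapping a continuous function between two indicators lets vague convergence control masses of
balls, at the price of a change of radius that doubling absorbs. -/
lemma exists_bump [OpensMeasurableSpace M] [ProperSpace M] (x : M) {a b : ℝ} (hab : a < b) :
    ∃ χ : M → ℝ, Continuous χ ∧ HasCompactSupport χ ∧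
      ∀ m : Measure M, IsLocallyFiniteMeasure m →
        m.real (Metric.ball x a) ≤ ∫ y, χ y ∂m ∧ ∫ y, χ y ∂m ≤ m.real (Metric.ball x b) := by
  have hba : 0 < b - a := sub_pos.2 hab
  set χ : M → ℝ := fun y => max 0 (min 1 ((b - dist y x) / (b - a))) with hχ
  have hcont : Continuous χ := by fun_prop
  have hzero : ∀ y, b ≤ dist y x → χ y = 0 := by
    intro y hy
    refine max_eq_left ((min_le_right _ _).trans ?_)
    exact div_nonpos_of_nonpos_of_nonneg (by linarith) hba.le
  have hsupp : HasCompactSupport χ := by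
    refine HasCompactSupport.intro (isCompact_closedBall x b) fun y hy => hzero y ?_
    exact (not_le.1 (fun h => hy (Metric.mem_closedBall.2 h))).le
  have hone : ∀ y ∈ Metric.ball x a, χ y = 1 := by
    intro y hy
    have : 1 ≤ (b - dist y x) / (b - a) := by
      rw [le_div_iff₀ hba]
      linarith [Metric.mem_ball.1 hy]
    simp only [hχ, min_eq_left this]
    norm_num
  have hle : ∀ y, χ y ≤ 1 := fun y => max_le zero_le_one (min_le_left _ _)
  refine ⟨χ, hcont, hsupp, fun m hm => ?_⟩
  have hint : Integrable χ m := hcont.integrable_of_hasCompactSupport hsupp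
  have hball : ∀ r, Integrable ((Metric.ball x r).indicator (1 : M → ℝ)) m := fun r =>
    (integrable_indicator_iff measurableSet_ball).2
      (integrableOn_const (measure_ball_lt_top.ne))
  rw [← integral_indicator_one (measurableSet_ball (x := x) (ε := a)),
    ← integral_indicator_one (measurableSet_ball (x := x) (ε := b))]
  constructor
  · refine integral_mono (hball a) hint fun y => ?_
    by_cases hy : y ∈ Metric.ball x a
    · rw [indicator_of_mem hy, hone y hy, Pi.one_apply]
    · rw [indicator_of_notMem hy]
      exact le_max_left _ _
  · refine integral_mono hint (hball b) fun y => ?_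
    by_cases hy : y ∈ Metric.ball x b
    · rw [indicator_of_mem hy]
      exact hle y
    · rw [indicator_of_notMem hy, hzero y (not_lt.1 fun h => hy (Metric.mem_ball.2 h))]

/-- Cut into dyadic shells: the mass grows by a factor `A` per shell while the weight shrinks by `2
^ d ≥ 2 A`, which leaves a geometric series of ratio `1/2`. -/
lemma lintegral_compl_ball_le [OpensMeasurableSpace M] {x : M} {m : Measure M} {A : ℝ≥0}
    (hgrow : ∀ i : ℕ, m (Metric.ball x (2 ^ i)) ≤ (A : ℝ≥0∞) ^ i * m (Metric.ball x 1)) {d : ℕ}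
    (hd : 2 * A ≤ 2 ^ d) (J : ℕ) :
    ∫⁻ y in (Metric.ball x (2 ^ J))ᶜ, (((1 + nndist y x) ^ d)⁻¹ : ℝ≥0) ∂m ≤
      ((2 * A * 2⁻¹ ^ J : ℝ≥0) : ℝ≥0∞) * m (Metric.ball x 1) := by
  set L : ℕ → Set M := fun i => Metric.ball x (2 ^ (i + J + 1)) \ Metric.ball x (2 ^ (i + J))
    with hL
  have hcov : (Metric.ball x (2 ^ J))ᶜ ⊆ ⋃ i, L i := by
    intro y hy
    have hy : ¬ dist y x < 2 ^ J := hy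
    have hex : ∃ n : ℕ, dist y x < 2 ^ n := pow_unbounded_of_one_lt _ one_lt_two
    classical
    have hJ : J < Nat.find hex := by
      by_contra hc
      have := (Nat.find_spec hex).trans_le (pow_le_pow_right₀ (one_le_two (α := ℝ)) (not_lt.1 hc))
      exact hy this
    obtain ⟨i, hi⟩ := Nat.exists_eq_add_of_lt hJ
    refine mem_iUnion.2 ⟨i, ?_, ?_⟩
    · have := Nat.find_spec hex
      rw [hi] at this
      rwa [Metric.mem_ball, add_comm i J]
    · have := Nat.find_min hex (m := i + J) (by omega)
      exact this
  have hterm : ∀ i, ∫⁻ y in L i, (((1 + nndist y x) ^ d)⁻¹ : ℝ≥0) ∂m ≤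
      ((A * 2⁻¹ ^ J * 2⁻¹ ^ i : ℝ≥0) : ℝ≥0∞) * m (Metric.ball x 1) := by
    intro i
    calc ∫⁻ y in L i, (((1 + nndist y x) ^ d)⁻¹ : ℝ≥0) ∂m
        ≤ ∫⁻ _ in L i, (((2 ^ d) ^ (i + J))⁻¹ : ℝ≥0) ∂m := by
          refine setLIntegral_mono measurable_const fun y hy => ?_
          have h1 : (2 : ℝ≥0) ^ (i + J) ≤ nndist y x := by
            have : ¬ dist y x < 2 ^ (i + J) := hy.2
            exact_mod_cast not_lt.1 this
          rw [ENNReal.coe_le_coe, ← pow_mul, mul_comm d, pow_mul]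
          gcongr
          exact h1.trans le_add_self
      _ = (((2 ^ d) ^ (i + J))⁻¹ : ℝ≥0) * m (L i) := setLIntegral_const _ _
      _ ≤ (((2 ^ d) ^ (i + J))⁻¹ : ℝ≥0) * ((A : ℝ≥0∞) ^ (i + J + 1) * m (Metric.ball x 1)) := by
          gcongr
          exact (measure_mono sdiff_subset).trans (hgrow _)
      _ ≤ _ := by
          rw [← mul_assoc, ← ENNReal.coe_pow, ← ENNReal.coe_mul]
          refine mul_le_mul_left (ENNReal.coe_le_coe.2 ?_) _
          rw [inv_mul_le_iff₀ (by positivity)]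
          calc A ^ (i + J + 1) = A * 2⁻¹ ^ J * 2⁻¹ ^ i * (2 * A) ^ (i + J) := by
                rw [mul_pow, mul_assoc A, ← pow_add, inv_pow, add_comm J i, pow_succ]
                field_simp
            _ ≤ A * 2⁻¹ ^ J * 2⁻¹ ^ i * (2 ^ d) ^ (i + J) := by gcongr
            _ = _ := by ring
  calc _ ≤ ∫⁻ y in ⋃ i, L i, (((1 + nndist y x) ^ d)⁻¹ : ℝ≥0) ∂m := lintegral_mono_set hcov
    _ ≤ ∑' i, ∫⁻ y in L i, (((1 + nndist y x) ^ d)⁻¹ : ℝ≥0) ∂m := lintegral_iUnion_le _ _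
    _ ≤ ∑' i, ((A * 2⁻¹ ^ J * 2⁻¹ ^ i : ℝ≥0) : ℝ≥0∞) * m (Metric.ball x 1) :=
        ENNReal.tsum_le_tsum hterm
    _ = _ := by
        rw [ENNReal.tsum_mul_right]
        congr 1
        have h2 : ∑' i : ℕ, ((2⁻¹ : ℝ≥0∞)) ^ i = 2 := by
          rw [ENNReal.tsum_geometric, ENNReal.one_sub_inv_two, inv_inv]
        have h3 : ∀ i : ℕ, ((A * 2⁻¹ ^ J * 2⁻¹ ^ i : ℝ≥0) : ℝ≥0∞) =
            ((A * 2⁻¹ ^ J : ℝ≥0) : ℝ≥0∞) * (2⁻¹ : ℝ≥0∞) ^ i := by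
          intro i
          rw [ENNReal.coe_mul, ENNReal.coe_pow, ENNReal.coe_inv two_ne_zero, ENNReal.coe_ofNat]
        rw [tsum_congr h3, ENNReal.tsum_mul_left, h2, ← ENNReal.coe_ofNat, ← ENNReal.coe_mul]
        congr 1
        ring

/-- Divided by the polynomial weight `ω` and normalised, the measures form a tight family of
probabilities, so a subsequence converges weakly. Multiplying the limit by `ω` again gives the vague
limit, since `ω f` is bounded and continuous for compactly supported `f`; the constants are the
inverse normalisations. -/
lemma exists_vague_limit [BorelSpace M] [ProperSpace M] (x : M) (m : ℕ → Measure M)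
    [∀ k, IsProbabilityMeasure (m k)] {A : ℝ≥0}
    (hgrow : ∀ k, ∀ i : ℕ,
      m k (Metric.ball x (2 ^ i)) ≤ (A : ℝ≥0∞) ^ i * m k (Metric.ball x 1))
    (hpos : ∀ k, m k (Metric.ball x 1) ≠ 0) :
    ∃ φ : ℕ → ℕ, StrictMono φ ∧ ∃ ν : Measure M, IsLocallyFiniteMeasure ν ∧ ν ≠ 0 ∧
      ∃ c : ℕ → ℝ, (∀ n, 0 < c n) ∧ ∀ f : M → ℝ, Continuous f → HasCompactSupport f →
        Tendsto (fun n => c n * ∫ y, f y ∂(m (φ n))) atTop (𝓝 (∫ y, f y ∂ν)) := by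
  obtain ⟨d, hd⟩ : ∃ d : ℕ, 2 * A ≤ 2 ^ d :=
    (pow_unbounded_of_one_lt (2 * A) one_lt_two).imp fun _ h => h.le
  set ω : M → ℝ≥0 := fun y => (1 + nndist y x) ^ d with hω
  have hω0 : ∀ y, ω y ≠ 0 := fun y => by positivity
  have hωc : Continuous ω := by fun_prop
  have hωi : Continuous fun y => (ω y)⁻¹ := hωc.inv₀ hω0
  set Z : ℕ → ℝ≥0∞ := fun k => ∫⁻ y, ((ω y)⁻¹ : ℝ≥0) ∂(m k) with hZ
  have hZlow : ∀ k, (((2 ^ d)⁻¹ : ℝ≥0) : ℝ≥0∞) * m k (Metric.ball x 1) ≤ Z k := by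
    intro k
    rw [← setLIntegral_const]
    refine le_trans (setLIntegral_mono (hωi.measurable.coe_nnreal_ennreal) fun y hy => ?_)
      (setLIntegral_le_lintegral _ _)
    rw [ENNReal.coe_le_coe]
    have : nndist y x ≤ 1 := (Metric.mem_ball.1 hy).le
    have h2 : 1 + nndist y x ≤ 2 := by
      calc 1 + nndist y x ≤ 1 + 1 := by gcongr
        _ = 2 := one_add_one_eq_two
    simp only [hω]
    gcongr
  have hZ0 : ∀ k, Z k ≠ 0 := fun k hk => by
    have := hZlow k
    rw [hk, nonpos_iff_eq_zero, mul_eq_zero] at this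
    rcases this with h | h
    · simp at h
    · exact hpos k h
  have hZtop : ∀ k, Z k ≠ ∞ := by
    intro k
    have : Z k ≤ 1 := by
      calc Z k ≤ ∫⁻ _, 1 ∂(m k) := by
            refine lintegral_mono fun y => ?_
            have : (ω y)⁻¹ ≤ 1 := inv_le_one_of_one_le₀ (one_le_pow₀ le_self_add)
            exact ENNReal.coe_le_one_iff.2 this
        _ = 1 := by simp
    exact ne_top_of_le_ne_top ENNReal.one_ne_top this
  set κ : ℕ → Measure M := fun k => (Z k)⁻¹ • (m k).withDensity fun y => ((ω y)⁻¹ : ℝ≥0) with hκ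
  have hκp : ∀ k, IsProbabilityMeasure (κ k) := by
    intro k
    constructor
    simp only [hκ, Measure.smul_apply, withDensity_apply _ MeasurableSet.univ, setLIntegral_univ,
      smul_eq_mul]
    exact ENNReal.inv_mul_cancel (hZ0 k) (hZtop k)
  set u : ℕ → ℝ≥0 := fun J => 2 ^ d * (2 * A * 2⁻¹ ^ J) with hu
  have hu0 : Tendsto u atTop (𝓝 0) := by
    have h1 : Tendsto (fun J : ℕ => (2⁻¹ : ℝ≥0) ^ J) atTop (𝓝 0) :=
      NNReal.tendsto_pow_atTop_nhds_zero_of_lt_one (by norm_num)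
    have h2 := (h1.const_mul (2 * A)).const_mul (2 ^ d)
    rwa [mul_zero, mul_zero] at h2
  have htail : ∀ k J, κ k (Metric.closedBall x (2 ^ J))ᶜ ≤ u J := by
    intro k J
    refine (measure_mono (compl_subset_compl.2 Metric.ball_subset_closedBall)).trans ?_
    simp only [hκ, Measure.smul_apply, smul_eq_mul]
    rw [withDensity_apply _ measurableSet_ball.compl, ENNReal.inv_mul_le_iff (hZ0 k) (hZtop k)]
    refine (lintegral_compl_ball_le (hgrow k) hd J).trans ?_
    calc ((2 * A * 2⁻¹ ^ J : ℝ≥0) : ℝ≥0∞) * m k (Metric.ball x 1)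
        = (u J : ℝ≥0∞) * ((((2 ^ d)⁻¹ : ℝ≥0) : ℝ≥0∞) * m k (Metric.ball x 1)) := by
          rw [← mul_assoc, ← ENNReal.coe_mul]
          congr 2
          simp only [hu]
          field_simp
      _ ≤ (u J : ℝ≥0∞) * Z k := by
          gcongr
          exact hZlow k
      _ = Z k * u J := mul_comm _ _
  have hcomp := isCompact_setOfPred_probabilityMeasure_mass_eq_compl_isCompact_le hu0
    (fun J => isCompact_closedBall x ((2 : ℝ) ^ J)) (Or.inl inferInstance)
  let κP : ℕ → ProbabilityMeasure M := fun k => ⟨κ k, hκp k⟩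
  obtain ⟨κ', -, φ, hφ, hlim⟩ := hcomp.tendsto_subseq (x := κP) (by
      intro k J
      rw [← ENNReal.coe_le_coe, ProbabilityMeasure.ennreal_coeFn_eq_coeFn_toMeasure]
      exact htail k J)
  rw [ProbabilityMeasure.tendsto_iff_forall_integral_tendsto] at hlim
  refine ⟨φ, hφ, (κ' : Measure M).withDensity fun y => (ω y : ℝ≥0∞),
    IsLocallyFiniteMeasure.withDensity_coe hωc, ?_, fun n => (Z (φ n)).toReal⁻¹,
    fun n => inv_pos.2 (ENNReal.toReal_pos (hZ0 _) (hZtop _)), fun f hf hfs => ?_⟩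
  · rw [Ne, withDensity_eq_zero_iff hωc.measurable.coe_nnreal_ennreal.aemeasurable]
    intro h
    have : ∀ᵐ y ∂(κ' : Measure M), False := by
      filter_upwards [h] with y hy
      exact hω0 y (by simpa using hy)
    exact IsProbabilityMeasure.ne_zero (κ' : Measure M) (by simpa using this)
  · have hg : Continuous fun y => ω y • f y := hωc.smul hf
    have hgs : HasCompactSupport fun y => ω y • f y := hfs.smul_left
    obtain ⟨C, hC⟩ := hgs.exists_bound_of_continuous hg
    have := hlim (BoundedContinuousFunction.ofNormedAddCommGroup _ hg C hC)
    rw [integral_withDensity_eq_integral_smul hωc.measurable]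
    refine this.congr fun n => ?_
    change ∫ y, ω y • f y ∂(κ (φ n)) = _
    simp only [hκ]
    rw [integral_smul_measure, integral_withDensity_eq_integral_smul hωi.measurable,
      ENNReal.toReal_inv, smul_eq_mul]
    congr 2
    ext y
    rw [smul_smul, inv_mul_cancel₀ (hω0 y), one_smul]

end Vague

/-! ### Tangent measures -/

section TangentMeasure

variable {N : ℕ} {F : Set (EuclideanSpace ℝ (Fin N))} {μ : Measure (EuclideanSpace ℝ (Fin N))}
  {A : ℝ} {x : EuclideanSpace ℝ (Fin N)}

lemma continuous_dilation (x : EuclideanSpace ℝ (Fin N)) (l : ℝ) :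
    Continuous fun y : EuclideanSpace ℝ (Fin N) => x + l⁻¹ • (y - x) := by
  fun_prop

lemma dilate_ball (μ : Measure (EuclideanSpace ℝ (Fin N))) (x : EuclideanSpace ℝ (Fin N)) {l : ℝ}
    (hl : 0 < l) (ρ : ℝ) : dilate μ x l (Metric.ball x ρ) = μ (Metric.ball x (ρ * l)) := by
  rw [dilate, Measure.map_apply (continuous_dilation x l).measurable measurableSet_ball]
  congr 1
  ext y
  rw [mem_preimage, Metric.mem_ball, Metric.mem_ball, dist_eq_norm, dist_eq_norm,
    add_sub_cancel_left, norm_smul, Real.norm_eq_abs, abs_of_pos (inv_pos.2 hl),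
    inv_mul_lt_iff₀ hl, mul_comm]

lemma isProbabilityMeasure_dilate [IsProbabilityMeasure μ] (x : EuclideanSpace ℝ (Fin N)) (l : ℝ) :
    IsProbabilityMeasure (dilate μ x l) :=
  Measure.isProbabilityMeasure_map (continuous_dilation x l).aemeasurable

namespace UniformBalls

/-- Bump functions and doubling place `ν(B(x,ρ))` within a constant factor of `c n * μ(B(x, ρ l n))`
for large `n`. Comparing `ρ` with `1` removes the unknown `c n`. -/
lemma growsLike_tangentMeasure (hU : UniformBalls F μ A) (hx : x ∈ F)
    {ν : Measure (EuclideanSpace ℝ (Fin N))} [IsLocallyFiniteMeasure ν] (hν : ν ≠ 0)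
    {c l : ℕ → ℝ} (hc : ∀ n, 0 < c n) (hl : ∀ n, 0 < l n)
    (hlim : ∀ f : EuclideanSpace ℝ (Fin N) → ℝ, Continuous f → HasCompactSupport f →
      Tendsto (fun n => c n * ∫ y, f y ∂(dilate μ x (l n))) atTop (𝓝 (∫ y, f y ∂ν))) :
    (∀ ρ > 0, 0 < ν.real (Metric.ball x ρ)) ∧
      GrowsLike (incr μ x) l (fun ρ => -Real.log (ν.real (Metric.ball x ρ))) := by
  have hprob := hU.isProbabilityMeasure
  have hA := hU.one_le hx
  have hA0 : 0 < A := by linarith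
  have hdil : ∀ n ρ, (dilate μ x (l n)).real (Metric.ball x ρ) =
      μ.real (Metric.ball x (ρ * l n)) := by
    intro n ρ
    rw [measureReal_def, dilate_ball μ x (hl n), measureReal_def]
  have hdp := fun n => isProbabilityMeasure_dilate (μ := μ) x (l n)
  have upper : ∀ ρ > 0, ∃ a : ℕ → ℝ, ∃ b, Tendsto a atTop (𝓝 b) ∧ ν.real (Metric.ball x ρ) ≤ b ∧
      ∀ n, a n ≤ A * (c n * μ.real (Metric.ball x (ρ * l n))) := by
    intro ρ hρ
    obtain ⟨χ, hχ, hχs, hχm⟩ := exists_bump x (show ρ < 2 * ρ by linarith)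
    refine ⟨_, _, hlim χ hχ hχs, (hχm ν inferInstance).1, fun n => ?_⟩
    have h1 := (hχm (dilate μ x (l n)) inferInstance).2
    rw [hdil, mul_assoc] at h1
    have h2 := h1.trans (hU.doubling x hx x hx (ρ * l n) (mul_pos hρ (hl n)))
    calc _ ≤ c n * (A * μ.real (Metric.ball x (ρ * l n))) :=
          mul_le_mul_of_nonneg_left h2 (hc n).le
      _ = _ := by ring
  have lower : ∀ ρ > 0, ∃ a : ℕ → ℝ, ∃ b, Tendsto a atTop (𝓝 b) ∧ b ≤ ν.real (Metric.ball x ρ) ∧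
      ∀ n, c n * μ.real (Metric.ball x (ρ * l n)) ≤ A * a n := by
    intro ρ hρ
    obtain ⟨χ, hχ, hχs, hχm⟩ := exists_bump x (show ρ / 2 < ρ by linarith)
    refine ⟨_, _, hlim χ hχ hχs, (hχm ν inferInstance).2, fun n => ?_⟩
    have h1 := (hχm (dilate μ x (l n)) inferInstance).1
    rw [hdil] at h1
    have h2 := hU.doubling x hx x hx (ρ / 2 * l n) (mul_pos (half_pos hρ) (hl n))
    rw [← mul_assoc, mul_div_cancel₀ _ two_ne_zero] at h2
    calc _ ≤ c n * (A * ∫ y, χ y ∂(dilate μ x (l n))) :=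
          mul_le_mul_of_nonneg_left
            (h2.trans (mul_le_mul_of_nonneg_left h1 hA0.le)) (hc n).le
      _ = _ := by ring
  obtain ⟨R, hR, hνR⟩ : ∃ R > 0, 0 < ν.real (Metric.ball x R) := by
    by_contra! hcon
    have h0 : ∀ n : ℕ, ν (Metric.ball x (n + 1)) = 0 := fun n => by
      rw [← measureReal_eq_zero_iff measure_ball_lt_top.ne]
      exact le_antisymm (hcon _ (by positivity)) measureReal_nonneg
    refine hν (Measure.measure_univ_eq_zero.1 ?_)
    have huniv : (⋃ n : ℕ, Metric.ball x ((n : ℝ) + 1)) = univ := by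
      refine eq_univ_of_forall fun y => ?_
      obtain ⟨n, hn⟩ := exists_nat_gt (dist y x)
      exact mem_iUnion.2 ⟨n, Metric.mem_ball.2 (by linarith)⟩
    rw [← huniv]
    exact measure_iUnion_null h0
  -- Positivity moves from radius `R` to `ρ` because the masses at `R * l n` and `ρ * l n` have a
  -- bounded ratio, uniformly in `n`.
  have hpos : ∀ ρ > 0, 0 < ν.real (Metric.ball x ρ) := by
    intro ρ hρ
    obtain ⟨D, hD⟩ := hU.exists_abs_incr_le hx (div_pos hρ hR) (ρ / R)
    obtain ⟨a, b, hab, hb, ha⟩ := upper R hR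
    obtain ⟨a', b', hab', hb', ha'⟩ := lower ρ hρ
    refine lt_of_lt_of_le ?_ hb'
    refine lt_of_lt_of_le (b := b / (A * Real.exp D * A)) (by
      have := hνR.trans_le hb
      positivity) (le_of_tendsto_of_tendsto' (hab.div_const _) hab' fun n => ?_)
    rw [div_le_iff₀ (by positivity)]
    have h1 := (abs_le.1 (hD (R * l n) (mul_pos hR (hl n)) (ρ / R) ⟨le_rfl, le_rfl⟩)).2
    have e : ρ / R * (R * l n) = ρ * l n := by field_simp
    have p1 := hU.pos hx (mul_pos hR (hl n))
    have p2 := hU.pos hx (mul_pos hρ (hl n))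
    rw [incr, e, ← Real.log_div p1.ne' p2.ne', Real.log_le_iff_le_exp (by positivity),
      div_le_iff₀ p2] at h1
    calc a n ≤ A * (c n * μ.real (Metric.ball x (R * l n))) := ha n
      _ ≤ A * (c n * (Real.exp D * μ.real (Metric.ball x (ρ * l n)))) := by
          have := hc n
          gcongr
      _ = A * Real.exp D * (c n * μ.real (Metric.ball x (ρ * l n))) := by ring
      _ ≤ A * Real.exp D * (A * a' n) := mul_le_mul_of_nonneg_left (ha' n) (by positivity)
      _ = _ := by ring
  refine ⟨hpos, ?_⟩
  have two : ∀ ρ > 0, ∀ᶠ n in atTop,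
      |Real.log (ν.real (Metric.ball x ρ)) -
        (Real.log (c n) + Real.log (μ.real (Metric.ball x (ρ * l n))))| ≤ Real.log (2 * A) := by
    intro ρ hρ
    have hνρ := hpos ρ hρ
    obtain ⟨a, b, hab, hb, ha⟩ := upper ρ hρ
    obtain ⟨a', b', hab', hb', ha'⟩ := lower ρ hρ
    filter_upwards [hab.eventually_const_lt (show ν.real (Metric.ball x ρ) / 2 < b by linarith),
      hab'.eventually_lt_const (show b' < 2 * ν.real (Metric.ball x ρ) by linarith)] with n h1 h2
    have p := hU.pos hx (mul_pos hρ (hl n))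
    have q := hc n
    have e1 := Real.log_le_log hνρ
      (show ν.real (Metric.ball x ρ) ≤ 2 * A * (c n * μ.real (Metric.ball x (ρ * l n))) by
        linarith [ha n])
    have e2 := Real.log_le_log (mul_pos q p)
      (show c n * μ.real (Metric.ball x (ρ * l n)) ≤ 2 * A * ν.real (Metric.ball x ρ) by
        nlinarith [ha' n])
    rw [Real.log_mul (by positivity) (by positivity), Real.log_mul q.ne' p.ne'] at e1
    rw [Real.log_mul q.ne' p.ne', Real.log_mul (by positivity) hνρ.ne'] at e2
    rw [abs_le]
    constructor <;> linarith
  refine ⟨2 * Real.log (2 * A) + |Real.log (ν.real (Metric.ball x 1))|, ?_⟩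
  filter_upwards [self_mem_nhdsWithin] with ρ hρ
  filter_upwards [two ρ hρ, two 1 one_pos] with n h1 h2
  rw [incr]
  rw [one_mul] at h2
  have h3 := abs_le.1 (le_refl |Real.log (ν.real (Metric.ball x 1))|)
  rw [abs_le] at h1 h2 ⊢
  constructor <;> linarith [h1.1, h1.2, h2.1, h2.2, h3.1, h3.2]

lemma log_localDim {ν : Measure (EuclideanSpace ℝ (Fin N))} [IsLocallyFiniteMeasure ν] {ρ : ℝ}
    (hν : 0 < ν.real (Metric.ball x ρ)) :
    ENNReal.log (ν (Metric.ball x ρ)) / ((Real.log ρ : ℝ) : EReal) =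
      ((-Real.log (ν.real (Metric.ball x ρ)) / Real.log (1 / ρ) : ℝ) : EReal) := by
  rw [← ofReal_measureReal (measure_ball_lt_top.ne), ENNReal.log_ofReal_of_pos hν,
    ← EReal.coe_div, one_div, Real.log_inv, neg_div_neg_eq]

/-- A tangent measure has local dimensions governed by the increments of `log μ(B(x,·))`. -/
lemma exists_growsLike_of_mem_tangentMeasures (hU : UniformBalls F μ A) (hx : x ∈ F)
    {ν : Measure (EuclideanSpace ℝ (Fin N))} (hν : IsLocallyFiniteMeasure ν) (hν0 : ν ≠ 0)
    {c l : ℕ → ℝ} (hc : ∀ n, 0 < c n) (hl : ∀ n, 0 < l n)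
    (hlim : ∀ f : EuclideanSpace ℝ (Fin N) → ℝ, Continuous f → HasCompactSupport f →
      Tendsto (fun n => c n * ∫ y, f y ∂(dilate μ x (l n))) atTop (𝓝 (∫ y, f y ∂ν))) :
    ∃ G : ℝ → ℝ, GrowsLike (incr μ x) l G ∧ lowerLocalDim ν x = localLiminf G ∧
      upperLocalDim ν x = localLimsup G := by
  obtain ⟨hpos, hG⟩ := hU.growsLike_tangentMeasure hx hν0 hc hl hlim
  refine ⟨_, hG, liminf_congr ?_, limsup_congr ?_⟩ <;>
  · filter_upwards [self_mem_nhdsWithin] with ρ hρ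
    exact log_localDim (hpos ρ hρ)

lemma exists_tangentMeasure (hU : UniformBalls F μ A) (hx : x ∈ F) {r : ℕ → ℝ}
    (hr : ∀ k, 0 < r k) :
    ∃ φ : ℕ → ℕ, StrictMono φ ∧ ∃ ν : Measure (EuclideanSpace ℝ (Fin N)),
      IsLocallyFiniteMeasure ν ∧ ν ≠ 0 ∧ ∃ c : ℕ → ℝ, (∀ n, 0 < c n) ∧
        ∀ f : EuclideanSpace ℝ (Fin N) → ℝ, Continuous f → HasCompactSupport f →
          Tendsto (fun n => c n * ∫ y, f y ∂(dilate μ x (r (φ n)))) atTop (𝓝 (∫ y, f y ∂ν)) := by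
  have hprob := hU.isProbabilityMeasure
  have hA := hU.one_le hx
  have := fun k => isProbabilityMeasure_dilate (μ := μ) x (r k)
  refine exists_vague_limit x (fun k => dilate μ x (r k)) (A := A.toNNReal) ?_ ?_
  · intro k i
    rw [dilate_ball μ x (hr k), dilate_ball μ x (hr k), one_mul, ← ofReal_measureReal,
      ← ofReal_measureReal]
    change _ ≤ ENNReal.ofReal A ^ i * _
    rw [← ENNReal.ofReal_pow (by linarith), ← ENNReal.ofReal_mul (by positivity)]
    exact ENNReal.ofReal_le_ofReal (hU.le_pow_mul hx i (hr k))
  · intro k h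
    rw [dilate_ball μ x (hr k), one_mul] at h
    have := hU.pos hx (hr k)
    rw [measureReal_def, h] at this
    simp at this

end UniformBalls

end TangentMeasure

/-! ### Existence of tangent sets -/

/-- Sequential compactness of sequences of sets for the Fell topology. -/
lemma exists_fell_limit {X : Type*} [TopologicalSpace X] [SecondCountableTopology X]
    (S : ℕ → Set X) :
    ∃ φ : ℕ → ℕ, StrictMono φ ∧ ∃ T : Set X, IsClosed T ∧
      (∀ z, z ∈ T ↔ ∀ U, IsOpen U → z ∈ U → ∀ᶠ k in atTop, (S (φ k) ∩ U).Nonempty) ∧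
      ∀ K, IsCompact K → Disjoint K T → ∀ᶠ k in atTop, Disjoint (S (φ k)) K := by
  classical
  let B := TopologicalSpace.countableBasis X
  have hB := TopologicalSpace.isBasis_countableBasis X
  have : Countable B := (TopologicalSpace.countable_countableBasis X).to_subtype
  -- Record which basic open sets each `S k` meets. These patterns live in a compact metrizable
  -- product of copies of `Bool`, so along a subsequence each entry is eventually constant.
  obtain ⟨a, φ, hφ, ha⟩ := CompactSpace.tendsto_subseq
    (fun k => (fun b : B => decide ((S k ∩ b).Nonempty) : B → Bool))
  have hev : ∀ b : B, ∀ᶠ k in atTop, decide ((S (φ k) ∩ b).Nonempty) = a b := by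
    intro b
    have := (tendsto_pi_nhds.1 ha) b
    rw [nhds_discrete, tendsto_pure] at this
    exact this
  have hnot : ∀ z, (¬ ∀ U, IsOpen U → z ∈ U → ∀ᶠ k in atTop, (S (φ k) ∩ U).Nonempty) →
      ∃ U, IsOpen U ∧ z ∈ U ∧ ∀ᶠ k in atTop, Disjoint (S (φ k)) U := by
    intro z hz
    push Not at hz
    obtain ⟨U, hU, hzU, hne⟩ := hz
    obtain ⟨b, hbB, hzb, hbU⟩ := hB.exists_subset_of_mem_open hzU hU
    refine ⟨b, hB.isOpen hbB, hzb, ?_⟩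
    have h1 := hev ⟨b, hbB⟩
    have h2 : a ⟨b, hbB⟩ = false := by
      by_contra hc
      rw [Bool.not_eq_false] at hc
      obtain ⟨k, hk, hk'⟩ := (hne.and_eventually h1).exists
      rw [hc, decide_eq_true_iff] at hk'
      have := hk'.mono (inter_subset_inter_right _ hbU)
      rw [hk] at this
      exact not_nonempty_empty this
    filter_upwards [h1] with k hk
    rw [h2, decide_eq_false_iff_not] at hk
    exact disjoint_iff_inter_eq_empty.2 (not_nonempty_iff_eq_empty.1 hk)
  set T : Set X := {z | ∀ U, IsOpen U → z ∈ U → ∀ᶠ k in atTop, (S (φ k) ∩ U).Nonempty} with hT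
  refine ⟨φ, hφ, T, ?_, fun z => Iff.rfl, fun K hK hKT => ?_⟩
  · rw [← isOpen_compl_iff, isOpen_iff_forall_mem_open]
    intro z hz
    obtain ⟨U, hU, hzU, hd⟩ := hnot z hz
    refine ⟨U, fun w hw hwT => ?_, hU, hzU⟩
    obtain ⟨k, hk, hk'⟩ := (hd.and (hwT U hU hw)).exists
    rw [disjoint_iff_inter_eq_empty.1 hk] at hk'
    exact not_nonempty_empty hk'
  · have hch : ∀ z ∈ K, ∃ U, IsOpen U ∧ z ∈ U ∧ ∀ᶠ k in atTop, Disjoint (S (φ k)) U :=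
      fun z hz => hnot z (disjoint_left.1 hKT hz)
    choose! U hUo hzU hd using hch
    obtain ⟨t, htK, ht⟩ := hK.elim_nhds_subcover U fun z hz => (hUo z hz).mem_nhds (hzU z hz)
    have : ∀ᶠ k in atTop, ∀ z ∈ t, Disjoint (S (φ k)) (U z) :=
      (Filter.eventually_all_finset t).2 fun z hz => hd z (htK z hz)
    filter_upwards [this] with k hk
    exact Disjoint.mono_right ht (disjoint_iUnion₂_right.2 hk)

/-- A Fell limit of the blow-ups of `F` at `x` is closed in Euclidean space, hence proper, and
contains `0`. On bounded balls the blow-ups and the limit are eventually close in both directions,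
and sending each point to a nearby limit point gives the almost isometry. -/
lemma exists_tangentSet {N : ℕ} {F : Set (EuclideanSpace ℝ (Fin N))}
    {x : EuclideanSpace ℝ (Fin N)} (hx : x ∈ F) {r : ℕ → ℝ} (hr : ∀ k, 0 < r k) :
    ∃ φ : ℕ → ℕ, StrictMono φ ∧ ∃ T : PointedProperSpace,
      PointedGHTendsto F x (fun k => (r (φ k))⁻¹) T := by
  classical
  obtain ⟨φ, hφ, T, hTc, hT, hTK⟩ := exists_fell_limit
    (fun k => {z : EuclideanSpace ℝ (Fin N) | x + r k • z ∈ F})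
  have h0 : (0 : EuclideanSpace ℝ (Fin N)) ∈ T := by
    refine (hT 0).2 fun U _ hU => Eventually.of_forall fun k => ⟨0, ?_, hU⟩
    simpa using hx
  have : ProperSpace T := ProperSpace.of_isClosed hTc
  refine ⟨φ, hφ, ⟨T, ⟨0, h0⟩⟩, fun R hR ε hε => ?_⟩
  have hb : ∀ᶠ k in atTop, ∀ z, x + r (φ k) • z ∈ F → ‖z‖ ≤ R → ∃ t ∈ T, dist z t < ε / 3 := by
    have hK : IsCompact (Metric.closedBall (0 : EuclideanSpace ℝ (Fin N)) R \
        Metric.thickening (ε / 3) T) :=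
      (isCompact_closedBall _ _).diff Metric.isOpen_thickening
    filter_upwards [hTK _ hK (disjoint_left.2 fun z hz hzT =>
      hz.2 (Metric.self_subset_thickening (by positivity) T hzT))] with k hk z hz hzR
    by_contra hc
    refine disjoint_left.1 hk hz ⟨mem_closedBall_zero_iff.2 hzR, fun h => hc ?_⟩
    exact Metric.mem_thickening_iff.1 h
  have ha : ∀ᶠ k in atTop, ∀ t ∈ T, ‖t‖ ≤ R → ∃ z, x + r (φ k) • z ∈ F ∧ dist t z < ε / 3 := by
    have hK : IsCompact (Metric.closedBall (0 : EuclideanSpace ℝ (Fin N)) R ∩ T) :=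
      (isCompact_closedBall _ _).inter_right hTc
    obtain ⟨c, hcK, hc⟩ := hK.elim_nhds_subcover (fun z => Metric.ball z (ε / 6))
      fun z _ => Metric.ball_mem_nhds z (by positivity)
    have : ∀ᶠ k in atTop, ∀ z ∈ c,
        ({z | x + r (φ k) • z ∈ F} ∩ Metric.ball z (ε / 6)).Nonempty :=
      (Filter.eventually_all_finset c).2 fun z hz => (hT z).1 (hcK z hz).2 _ Metric.isOpen_ball
        (Metric.mem_ball_self (by positivity))
    filter_upwards [this] with k hk t ht htR
    obtain ⟨z, hz, htz⟩ := mem_iUnion₂.1 (hc ⟨mem_closedBall_zero_iff.2 htR, ht⟩)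
    obtain ⟨w, hw, hwz⟩ := hk z hz
    refine ⟨w, hw, ?_⟩
    have h1 := Metric.mem_ball.1 htz
    have h2 := Metric.mem_ball'.1 hwz
    linarith [dist_triangle t z w]
  filter_upwards [ha, hb] with k hka hkb
  set s := (r (φ k))⁻¹ with hs
  have hrk := hr (φ k)
  have hs0 : 0 < s := inv_pos.2 hrk
  have hsc : ∀ y : EuclideanSpace ℝ (Fin N), x + r (φ k) • (s • (y - x)) = y := fun y => by
    rw [smul_smul, hs, mul_inv_cancel₀ hrk.ne', one_smul, add_sub_cancel]
  have hnorm : ∀ y : EuclideanSpace ℝ (Fin N), ‖s • (y - x)‖ = s * dist y x := fun y => by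
    rw [norm_smul, Real.norm_eq_abs, abs_of_pos hs0, dist_eq_norm]
  have hdist : ∀ y z : EuclideanSpace ℝ (Fin N),
      dist (s • (y - x)) (s • (z - x)) = s * dist y z := fun y z => by
    rw [dist_eq_norm, ← smul_sub, sub_sub_sub_cancel_right, norm_smul, Real.norm_eq_abs,
      abs_of_pos hs0, dist_eq_norm]
  -- The centre is treated separately because it must go exactly to the base point.
  have hch : ∀ y : EuclideanSpace ℝ (Fin N), ∃ t : T, (y = x → t = ⟨0, h0⟩) ∧
      (y ∈ F → s * dist y x < R → dist (s • (y - x)) (t : EuclideanSpace ℝ (Fin N)) < ε / 3) := by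
    intro y
    by_cases hy : y = x
    · refine ⟨⟨0, h0⟩, fun _ => rfl, fun _ _ => ?_⟩
      rw [hy, sub_self, smul_zero, dist_self]
      positivity
    · by_cases hyF : y ∈ F ∧ s * dist y x < R
      · obtain ⟨t, ht, htd⟩ := hkb (s • (y - x)) (by rw [hsc]; exact hyF.1)
          (by rw [hnorm]; exact hyF.2.le)
        exact ⟨⟨t, ht⟩, fun h => absurd h hy, fun _ _ => htd⟩
      · exact ⟨⟨0, h0⟩, fun _ => rfl, fun h1 h2 => absurd ⟨h1, h2⟩ hyF⟩
  choose f hfx hf using hch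
  refine ⟨f, hfx x rfl, fun y hy z hz hyR hzR => ?_, fun t ht => ?_⟩
  · have h1 := hf y hy hyR
    have h2 := hf z hz hzR
    have h3 := hdist y z
    rw [Subtype.dist_eq, ← h3, abs_lt]
    have h1' := h1
    have h2' := h2
    rw [dist_comm] at h1' h2'
    constructor
    · linarith [dist_triangle4 (s • (y - x)) (f y : EuclideanSpace ℝ (Fin N)) (f z) (s • (z - x))]
    · linarith [dist_triangle4 (f y : EuclideanSpace ℝ (Fin N)) (s • (y - x)) (s • (z - x)) (f z)]
  · have htn : ‖(t : EuclideanSpace ℝ (Fin N))‖ < R - ε := by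
      rw [← dist_zero_right]
      exact ht
    obtain ⟨z, hz, htz⟩ := hka t t.2 (by linarith)
    have e : s • ((x + r (φ k) • z) - x) = z := by
      rw [add_sub_cancel_left, smul_smul, hs, inv_mul_cancel₀ hrk.ne', one_smul]
    have hzR : s * dist (x + r (φ k) • z) x < R := by
      rw [← hnorm, e]
      have := dist_triangle z t 0
      rw [dist_zero_right, dist_zero_right, dist_comm] at this
      linarith
    refine ⟨x + r (φ k) • z, hz, hzR, ?_⟩
    have := hf _ hz hzR
    rw [e] at this
    change dist (t : EuclideanSpace ℝ (Fin N)) (f _) < ε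
    linarith [dist_triangle (t : EuclideanSpace ℝ (Fin N)) z (f (x + r (φ k) • z))]

/-! ### Extrema over tangent measures and tangent sets -/

namespace UniformBalls

variable {N : ℕ} {F : Set (EuclideanSpace ℝ (Fin N))} {μ : Measure (EuclideanSpace ℝ (Fin N))}
  {A : ℝ} {x : EuclideanSpace ℝ (Fin N)}

lemma exists_scales_lower (hU : UniformBalls F μ A) (hx : x ∈ F) {δ : ℝ}
    (hδ : tangLiminf (incr μ x) < δ) :
    ∃ r : ℕ → ℝ, (∀ k, 0 < r k) ∧ Antitone r ∧ Tendsto r atTop (𝓝 0) ∧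
      ∀ l ∈ Ioo (0 : ℝ) 1, ∀ᶠ k in atTop, incr μ x l (r k) ≤ δ * Real.log (1 / l) + 1 :=
  exists_scales (H := fun r => Real.log (μ.real (Metric.ball x r)))
    (fun _ ha => hU.exists_abs_incr_le hx ha.1 1) hδ

lemma exists_scales_upper (hU : UniformBalls F μ A) (hx : x ∈ F) {δ : ℝ}
    (hδ : δ < tangLimsup (incr μ x)) :
    ∃ r : ℕ → ℝ, (∀ k, 0 < r k) ∧ Antitone r ∧ Tendsto r atTop (𝓝 0) ∧
      ∀ l ∈ Ioo (0 : ℝ) 1, ∀ᶠ k in atTop, δ * Real.log (1 / l) - 1 ≤ incr μ x l (r k) := by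
  have hneg : ∀ l r, -Real.log (μ.real (Metric.ball x r)) -
      -Real.log (μ.real (Metric.ball x (l * r))) = -incr μ x l r := fun l r => by
    rw [incr]
    ring
  obtain ⟨r, h1, h2, h3, h4⟩ :=
    exists_scales (H := fun r => -Real.log (μ.real (Metric.ball x r))) (δ := -δ)
      (fun a ha => by
        obtain ⟨D, hD⟩ := hU.exists_abs_incr_le hx ha.1 1
        refine ⟨D, fun r hr l hl => ?_⟩
        rw [hneg, abs_neg]
        exact hD r hr l hl)
      (by
        simp only [hneg]
        rw [tangLiminf_neg, EReal.coe_neg, EReal.neg_lt_neg_iff]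
        exact hδ)
  refine ⟨r, h1, h2, h3, fun l hl => (h4 l hl).mono fun k hk => ?_⟩
  rw [hneg] at hk
  linarith

lemma growsLike_of_mem_tangentMeasures (hU : UniformBalls F μ A) (hx : x ∈ F)
    {ν : Measure (EuclideanSpace ℝ (Fin N))} (hν : ν ∈ tangentMeasures μ x) :
    tangLiminf (incr μ x) ≤ lowerLocalDim ν x ∧ upperLocalDim ν x ≤ tangLimsup (incr μ x) := by
  obtain ⟨hfin, hν0, c, l, hc, hl, -, hl0, hlim⟩ := hν
  obtain ⟨G, hG, e1, e2⟩ := hU.exists_growsLike_of_mem_tangentMeasures hx hfin hν0 hc hl hlim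
  have hl' : Tendsto l atTop (𝓝[>] 0) :=
    tendsto_nhdsWithin_iff.2 ⟨hl0, Eventually.of_forall hl⟩
  rw [e1, e2]
  exact ⟨hG.tangLiminf_le hl', hG.le_tangLimsup hl'⟩

lemma exists_mem_tangentMeasures (hU : UniformBalls F μ A) (hx : x ∈ F) {r : ℕ → ℝ}
    (hr : ∀ k, 0 < r k) (hr' : Antitone r) (hr0 : Tendsto r atTop (𝓝 0)) :
    ∃ φ : ℕ → ℕ, StrictMono φ ∧ ∃ ν ∈ tangentMeasures μ x, ∃ G, GrowsLike (incr μ x) (r ∘ φ) G ∧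
      lowerLocalDim ν x = localLiminf G ∧ upperLocalDim ν x = localLimsup G := by
  obtain ⟨φ, hφ, ν, hν, hν0, c, hc, hlim⟩ := hU.exists_tangentMeasure hx hr
  exact ⟨φ, hφ, ν, ⟨hν, hν0, c, r ∘ φ, hc, fun n => hr _, hr'.comp_monotone hφ.monotone,
    hr0.comp hφ.tendsto_atTop, hlim⟩,
    hU.exists_growsLike_of_mem_tangentMeasures hx hν hν0 hc (fun n => hr _) hlim⟩

lemma tangLiminf_eq_iInf_tangentMeasures (hU : UniformBalls F μ A) (hx : x ∈ F) :
    tangLiminf (incr μ x) = ⨅ ν ∈ tangentMeasures μ x, lowerLocalDim ν x := by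
  refine le_antisymm
    (le_iInf₂ fun ν hν => (hU.growsLike_of_mem_tangentMeasures hx hν).1) ?_
  refine EReal.le_of_forall_lt_iff_le.1 fun δ hδ => ?_
  obtain ⟨r, h1, h2, h3, h4⟩ := hU.exists_scales_lower hx hδ
  obtain ⟨φ, hφ, ν, hν, G, hG, e, -⟩ := hU.exists_mem_tangentMeasures hx h1 h2 h3
  refine (iInf₂_le ν hν).trans ?_
  rw [e]
  exact (localLiminf_le_localLimsup G).trans
    (hG.localLimsup_le fun l hl => hφ.tendsto_atTop.eventually (h4 l hl))

lemma tangLimsup_eq_iSup_tangentMeasures (hU : UniformBalls F μ A) (hx : x ∈ F) :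
    tangLimsup (incr μ x) = ⨆ ν ∈ tangentMeasures μ x, upperLocalDim ν x := by
  refine le_antisymm ?_
    (iSup₂_le fun ν hν => (hU.growsLike_of_mem_tangentMeasures hx hν).2)
  refine EReal.ge_of_forall_gt_iff_ge.1 fun δ hδ => ?_
  obtain ⟨r, h1, h2, h3, h4⟩ := hU.exists_scales_upper hx hδ
  obtain ⟨φ, hφ, ν, hν, G, hG, -, e⟩ := hU.exists_mem_tangentMeasures hx h1 h2 h3
  refine le_trans ?_ (le_iSup₂ (f := fun ν _ => upperLocalDim ν x) ν hν)
  simp only [e]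
  exact (hG.le_localLiminf fun l hl => hφ.tendsto_atTop.eventually (h4 l hl)).trans
    (localLiminf_le_localLimsup G)

lemma tangLiminf_le_lowerLocalBoxDim (hU : UniformBalls F μ A) (hx : x ∈ F)
    {T : PointedProperSpace} (hT : T ∈ tangentSets F x) :
    tangLiminf (incr μ x) ≤ lowerLocalBoxDim T.base := by
  obtain ⟨s, hs, hT⟩ := hT
  refine le_iInf₂ fun R hR => ?_
  obtain ⟨G, hG, e, -⟩ := hU.exists_growsLike_tangent hx hs hT hR
  rw [e]
  exact hG.tangLiminf_le (tendsto_inv_atTop_nhdsGT_zero.comp hs)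

lemma upperLocalBoxDim_le_tangLimsup (hU : UniformBalls F μ A) (hx : x ∈ F)
    {T : PointedProperSpace} (hT : T ∈ tangentSets F x) :
    upperLocalBoxDim T.base ≤ tangLimsup (incr μ x) := by
  obtain ⟨s, hs, hT⟩ := hT
  refine (iInf₂_le 1 one_pos).trans ?_
  obtain ⟨G, hG, -, e⟩ := hU.exists_growsLike_tangent hx hs hT one_pos
  rw [e]
  exact hG.le_tangLimsup (tendsto_inv_atTop_nhdsGT_zero.comp hs)

lemma lowerLocalBoxDim_le_upperLocalBoxDim {M : Type*} [MetricSpace M] (o : M) :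
    lowerLocalBoxDim o ≤ upperLocalBoxDim o :=
  iInf₂_mono fun _ _ => liminf_le_limsup

lemma exists_upperLocalBoxDim_le (hU : UniformBalls F μ A) (hx : x ∈ F) {δ : ℝ}
    (hδ : tangLiminf (incr μ x) < δ) :
    ∃ T ∈ tangentSets F x, upperLocalBoxDim T.base ≤ δ := by
  obtain ⟨r, h1, -, h3, h4⟩ := hU.exists_scales_lower hx hδ
  obtain ⟨φ, hφ, T, hT⟩ := exists_tangentSet hx h1
  have hr : Tendsto (r ∘ φ) atTop (𝓝[>] 0) :=
    tendsto_nhdsWithin_iff.2 ⟨h3.comp hφ.tendsto_atTop, Eventually.of_forall fun _ => h1 _⟩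
  have hs : Tendsto (fun k => (r (φ k))⁻¹) atTop atTop := tendsto_inv_nhdsGT_zero.comp hr
  refine ⟨T, ⟨_, hs, hT⟩, (iInf₂_le 1 one_pos).trans ?_⟩
  obtain ⟨G, hG, -, e⟩ := hU.exists_growsLike_tangent hx hs hT one_pos
  rw [e]
  refine hG.localLimsup_le fun l hl => ?_
  simp only [inv_inv]
  exact hφ.tendsto_atTop.eventually (h4 l hl)

/-- The local box dimension is an infimum over `R`, so a lower bound has to treat every `R`, whereas
upper bounds only use `R = 1`. -/
lemma exists_le_lowerLocalBoxDim (hU : UniformBalls F μ A) (hx : x ∈ F) {δ : ℝ}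
    (hδ : δ < tangLimsup (incr μ x)) :
    ∃ T ∈ tangentSets F x, δ ≤ lowerLocalBoxDim T.base := by
  obtain ⟨r, h1, -, h3, h4⟩ := hU.exists_scales_upper hx hδ
  obtain ⟨φ, hφ, T, hT⟩ := exists_tangentSet hx h1
  have hr : Tendsto (r ∘ φ) atTop (𝓝[>] 0) :=
    tendsto_nhdsWithin_iff.2 ⟨h3.comp hφ.tendsto_atTop, Eventually.of_forall fun _ => h1 _⟩
  have hs : Tendsto (fun k => (r (φ k))⁻¹) atTop atTop := tendsto_inv_nhdsGT_zero.comp hr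
  refine ⟨T, ⟨_, hs, hT⟩, le_iInf₂ fun R hR => ?_⟩
  obtain ⟨G, hG, e, -⟩ := hU.exists_growsLike_tangent hx hs hT hR
  rw [e]
  refine hG.le_localLiminf fun l hl => ?_
  simp only [inv_inv]
  exact hφ.tendsto_atTop.eventually (h4 l hl)

theorem tangLiminf_eq_iInf_tangentSets (hU : UniformBalls F μ A) (hx : x ∈ F) :
    tangLiminf (incr μ x) = (⨅ T ∈ tangentSets F x, lowerLocalBoxDim T.base) ∧
      tangLiminf (incr μ x) = ⨅ T ∈ tangentSets F x, upperLocalBoxDim T.base := by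
  have h1 : tangLiminf (incr μ x) ≤ ⨅ T ∈ tangentSets F x, lowerLocalBoxDim T.base :=
    le_iInf₂ fun T hT => hU.tangLiminf_le_lowerLocalBoxDim hx hT
  have h2 : (⨅ T ∈ tangentSets F x, lowerLocalBoxDim T.base) ≤
      ⨅ T ∈ tangentSets F x, upperLocalBoxDim T.base :=
    iInf₂_mono fun T _ => lowerLocalBoxDim_le_upperLocalBoxDim T.base
  have h3 : (⨅ T ∈ tangentSets F x, upperLocalBoxDim T.base) ≤ tangLiminf (incr μ x) := by
    refine EReal.le_of_forall_lt_iff_le.1 fun δ hδ => ?_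
    obtain ⟨T, hT, hTδ⟩ := hU.exists_upperLocalBoxDim_le hx hδ
    exact (iInf₂_le T hT).trans hTδ
  exact ⟨le_antisymm h1 (h2.trans h3), le_antisymm (h1.trans h2) h3⟩

theorem tangLimsup_eq_iSup_tangentSets (hU : UniformBalls F μ A) (hx : x ∈ F) :
    tangLimsup (incr μ x) = (⨆ T ∈ tangentSets F x, lowerLocalBoxDim T.base) ∧
      tangLimsup (incr μ x) = ⨆ T ∈ tangentSets F x, upperLocalBoxDim T.base := by
  have h1 : (⨆ T ∈ tangentSets F x, upperLocalBoxDim T.base) ≤ tangLimsup (incr μ x) :=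
    iSup₂_le fun T hT => hU.upperLocalBoxDim_le_tangLimsup hx hT
  have h2 : (⨆ T ∈ tangentSets F x, lowerLocalBoxDim T.base) ≤
      ⨆ T ∈ tangentSets F x, upperLocalBoxDim T.base :=
    iSup₂_mono fun T _ => lowerLocalBoxDim_le_upperLocalBoxDim T.base
  have h3 : tangLimsup (incr μ x) ≤ ⨆ T ∈ tangentSets F x, lowerLocalBoxDim T.base := by
    refine EReal.ge_of_forall_gt_iff_ge.1 fun δ hδ => ?_
    obtain ⟨T, hT, hTδ⟩ := hU.exists_le_lowerLocalBoxDim hx hδ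
    exact hTδ.trans (le_iSup₂ (f := fun (T : PointedProperSpace) (_ : T ∈ tangentSets F x) =>
      lowerLocalBoxDim T.base) T hT)
  exact ⟨le_antisymm h3 (h2.trans h1), le_antisymm (h3.trans h2) h1⟩

end UniformBalls

/-! ### Cells of a translation fractal -/

/-- A sequence of families of at least two and at most boundedly many similarities, with a common
ratio in each family, which satisfies the open set condition. -/
structure SimilaritySystem {N : ℕ} {p : ℕ → ℕ}
    (w : (n : ℕ) → Fin (p n) → EuclideanSpace ℝ (Fin N) → EuclideanSpace ℝ (Fin N)) (lam : ℕ → ℝ)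
    (V : Set (EuclideanSpace ℝ (Fin N))) : Prop where
  two_le : ∀ n, 2 ≤ p n
  bddAbove : BddAbove (Set.range p)
  ratio_mem : ∀ n, lam n ∈ Set.Ioo (0 : ℝ) 1
  dist_map : ∀ n j y z, dist (w n j y) (w n j z) = lam n * dist y z
  openSet : RegularOpenSetCondition w V

/-- The ratio of the maps `w_σ` for words `σ` of length `n`. -/
def wordRatio (lam : ℕ → ℝ) (n : ℕ) : ℝ := ∏ k ∈ Finset.range n, lam k

/-- The number of words of length `n`. -/
def wordCount (p : ℕ → ℕ) (n : ℕ) : ℕ := ∏ k ∈ Finset.range n, p k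

/-- A Haar measure which scales well under maps that expand distances. -/
abbrev haar (N : ℕ) : Measure (EuclideanSpace ℝ (Fin N)) :=
  Measure.hausdorffMeasure ((Module.finrank ℝ (EuclideanSpace ℝ (Fin N)) : ℕ) : ℝ)

namespace SimilaritySystem

variable {N : ℕ} {p : ℕ → ℕ}
  {w : (n : ℕ) → Fin (p n) → EuclideanSpace ℝ (Fin N) → EuclideanSpace ℝ (Fin N)} {lam : ℕ → ℝ}
  {V : Set (EuclideanSpace ℝ (Fin N))}

lemma wordRatio_pos (hS : SimilaritySystem w lam V) (n : ℕ) : 0 < wordRatio lam n :=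
  Finset.prod_pos fun k _ => (hS.ratio_mem k).1

lemma wordCount_pos (hS : SimilaritySystem w lam V) (n : ℕ) : 0 < wordCount p n :=
  Finset.prod_pos fun k _ => by linarith [hS.two_le k]

lemma dist_wordMap (hS : SimilaritySystem w lam V) (n : ℕ) (σ : (k : Fin n) → Fin (p k))
    (y z : EuclideanSpace ℝ (Fin N)) :
    dist (wordMap w n σ y) (wordMap w n σ z) = wordRatio lam n * dist y z := by
  induction n generalizing y z with
  | zero => simp [wordMap, wordRatio]
  | succ n ih =>
    rw [wordMap, Function.comp_apply, Function.comp_apply, ih, hS.dist_map, wordRatio, wordRatio,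
      Finset.prod_range_succ]
    ring

lemma injective_wordMap (hS : SimilaritySystem w lam V) (n : ℕ) (σ : (k : Fin n) → Fin (p k)) :
    Function.Injective (wordMap w n σ) := fun y z h => by
  have := hS.dist_wordMap n σ y z
  rw [h, dist_self, eq_comm, mul_eq_zero] at this
  exact dist_eq_zero.1 (this.resolve_left (hS.wordRatio_pos n).ne')

lemma continuous_wordMap (hS : SimilaritySystem w lam V) (n : ℕ) (σ : (k : Fin n) → Fin (p k)) :
    Continuous (wordMap w n σ) :=
  (LipschitzWith.of_dist_le_mul (K := ⟨wordRatio lam n, (hS.wordRatio_pos n).le⟩)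
    fun y z => (hS.dist_wordMap n σ y z).le).continuous

lemma image_closure_subset (hS : SimilaritySystem w lam V) (n : ℕ) (j : Fin (p n)) :
    w n j '' closure V ⊆ closure V := by
  have hcont : Continuous (w n j) :=
    (LipschitzWith.of_dist_le_mul (K := ⟨lam n, (hS.ratio_mem n).1.le⟩)
      fun y z => (hS.dist_map n j y z).le).continuous
  exact (image_closure_subset_closure_image hcont).trans
    (closure_mono (hS.openSet.image_subset n j))

lemma wordMap_image_subset (hS : SimilaritySystem w lam V) (n : ℕ) (σ : (k : Fin n) → Fin (p k)) :
    wordMap w n σ '' V ⊆ V := by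
  induction n with
  | zero => simp [wordMap]
  | succ n ih =>
    rw [wordMap, image_comp]
    exact (image_mono (hS.openSet.image_subset _ _)).trans (ih _)

lemma wordMap_succ_image_closure_subset (hS : SimilaritySystem w lam V) (n : ℕ)
    (σ : (k : Fin (n + 1)) → Fin (p k)) :
    wordMap w (n + 1) σ '' closure V ⊆ wordMap w n (fun k => σ k.castSucc) '' closure V := by
  rw [wordMap, image_comp]
  exact image_mono (hS.image_closure_subset _ _)

lemma disjoint_wordMap_image (hS : SimilaritySystem w lam V) (n : ℕ)
    {σ τ : (k : Fin n) → Fin (p k)} (hστ : σ ≠ τ) :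
    Disjoint (wordMap w n σ '' V) (wordMap w n τ '' V) := by
  induction n with
  | zero => exact absurd (Subsingleton.elim σ τ) hστ
  | succ n ih =>
    rw [wordMap, wordMap, image_comp, image_comp]
    by_cases h : (fun k : Fin n => σ k.castSucc) = fun k : Fin n => τ k.castSucc
    · have hlast : σ (Fin.last n) ≠ τ (Fin.last n) := fun hl => hστ <| by
        funext k
        refine Fin.lastCases hl (fun i => congrFun h i) k
      rw [h, disjoint_image_iff (hS.injective_wordMap _ _)]
      exact hS.openSet.disjoint _ _ _ hlast
    · exact (ih h).mono (image_mono (hS.openSet.image_subset _ _))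
        (image_mono (hS.openSet.image_subset _ _))

/-! ### Counting cells by volume -/

lemma haar_pos (hS : SimilaritySystem w lam V) : 0 < (haar N).real V :=
  ENNReal.toReal_pos (hS.openSet.isOpen.measure_pos _ hS.openSet.nonempty).ne'
    hS.openSet.bounded.measure_lt_top.ne

lemma mul_haar_le (hS : SimilaritySystem w lam V) (n : ℕ) (σ : (k : Fin n) → Fin (p k)) :
    wordRatio lam n ^ (Module.finrank ℝ (EuclideanSpace ℝ (Fin N))) * (haar N).real V ≤
      (haar N).real (wordMap w n σ '' V) := by
  have hr := hS.wordRatio_pos n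
  have hanti : AntilipschitzWith (wordRatio lam n).toNNReal⁻¹ (wordMap w n σ) := by
    refine AntilipschitzWith.of_le_mul_dist fun y z => ?_
    rw [hS.dist_wordMap, NNReal.coe_inv, Real.coe_toNNReal _ hr.le,
      inv_mul_cancel_left₀ hr.ne']
  have h1 := hanti.le_hausdorffMeasure_image
    (Nat.cast_nonneg (Module.finrank ℝ (EuclideanSpace ℝ (Fin N)))) V
  have hfin : (haar N) (wordMap w n σ '' V) ≠ ∞ :=
    (hS.openSet.bounded.subset (hS.wordMap_image_subset n σ)).measure_lt_top.ne
  have h2 := ENNReal.toReal_mono (ENNReal.mul_ne_top (by simp) hfin) h1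
  rw [ENNReal.toReal_mul, ENNReal.rpow_natCast, ENNReal.toReal_pow, ENNReal.coe_toReal,
    NNReal.coe_inv, Real.coe_toNNReal _ hr.le, inv_pow] at h2
  rw [← le_inv_mul_iff₀ (by positivity)]
  exact h2

lemma card_mul_le (hS : SimilaritySystem w lam V) (n : ℕ) (s : Finset ((k : Fin n) → Fin (p k)))
    {Q : Set (EuclideanSpace ℝ (Fin N))} (hQ : Bornology.IsBounded Q)
    (hs : ∀ σ ∈ s, wordMap w n σ '' V ⊆ Q) :
    s.card * (wordRatio lam n ^ (Module.finrank ℝ (EuclideanSpace ℝ (Fin N))) * (haar N).real V) ≤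
      (haar N).real Q := by
  calc s.card * (wordRatio lam n ^ (Module.finrank ℝ (EuclideanSpace ℝ (Fin N))) * (haar N).real V)
      = ∑ σ ∈ s, wordRatio lam n ^ (Module.finrank ℝ (EuclideanSpace ℝ (Fin N))) *
          (haar N).real V := by simp
    _ ≤ ∑ σ ∈ s, (haar N).real (wordMap w n σ '' V) :=
        Finset.sum_le_sum fun σ _ => hS.mul_haar_le n σ
    _ = (haar N).real (⋃ σ ∈ s, wordMap w n σ '' V) := by
        rw [measureReal_biUnion_finset (fun σ _ τ _ h => hS.disjoint_wordMap_image n h)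
          (fun σ _ => hS.openSet.isOpen.measurableSet.image_of_continuousOn_injOn
            (hS.continuous_wordMap n σ).continuousOn (hS.injective_wordMap n σ).injOn)
          (fun σ _ => (hS.openSet.bounded.subset (hS.wordMap_image_subset n σ)).measure_lt_top.ne)]
    _ ≤ _ := measureReal_mono (iUnion₂_subset hs) hQ.measure_lt_top.ne

lemma card_words (n : ℕ) : Fintype.card ((k : Fin n) → Fin (p k)) = wordCount p n := by
  rw [Fintype.card_pi, wordCount, ← Fin.prod_univ_eq_prod_range]
  simp

/-- The ratios may approach `1`, so this needs the open set condition: at least `2 ^ n` disjoint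
copies of `V` fit into `V`, hence the `d`-th power of the ratio is at most `2 ^ (-n)`. -/
lemma tendsto_wordRatio (hS : SimilaritySystem w lam V) :
    Tendsto (wordRatio lam) atTop (𝓝 0) := by
  set d := Module.finrank ℝ (EuclideanSpace ℝ (Fin N)) with hd
  have hle : ∀ n, wordRatio lam n ^ d ≤ (1 / 2) ^ n := by
    intro n
    have h := hS.card_mul_le n Finset.univ hS.openSet.bounded
      fun σ _ => hS.wordMap_image_subset n σ
    rw [Finset.card_univ, card_words, ← mul_assoc] at h
    have h1 : (wordCount p n : ℝ) * wordRatio lam n ^ d ≤ 1 :=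
      le_of_mul_le_mul_right (by rwa [one_mul]) hS.haar_pos
    have h2 : (2 : ℝ) ^ n ≤ wordCount p n := by
      have : 2 ^ n ≤ wordCount p n := by
        rw [wordCount]
        calc 2 ^ n = ∏ _k ∈ Finset.range n, 2 := by simp
          _ ≤ _ := Finset.prod_le_prod' fun k _ => hS.two_le k
      exact_mod_cast this
    have h3 := mul_le_mul_of_nonneg_right h2 (pow_nonneg (hS.wordRatio_pos n).le d)
    rw [one_div, inv_pow, ← one_div, le_div_iff₀ (by positivity)]
    linarith
  -- In dimension `0` the bound at `n = 1` would read `1 ≤ 1/2`.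
  have hd0 : d ≠ 0 := by
    intro h0
    have := hle 1
    rw [h0] at this
    norm_num at this
  have hpow : Tendsto (fun n => wordRatio lam n ^ d) atTop (𝓝 0) :=
    squeeze_zero (fun n => pow_nonneg (hS.wordRatio_pos n).le d) hle
      (tendsto_pow_atTop_nhds_zero_of_lt_one (by norm_num) (by norm_num))
  refine Metric.tendsto_atTop.2 fun ε hε => ?_
  obtain ⟨n₀, hn₀⟩ := Metric.tendsto_atTop.1 hpow (ε ^ d) (by positivity)
  refine ⟨n₀, fun n hn => ?_⟩
  have := hn₀ n hn
  have hr := hS.wordRatio_pos n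
  rw [Real.dist_0_eq_abs, abs_of_pos (by positivity)] at this
  rw [Real.dist_0_eq_abs, abs_of_pos hr]
  exact lt_of_pow_lt_pow_left₀ d hε.le this

lemma isCompact_closure (hS : SimilaritySystem w lam V) : IsCompact (closure V) :=
  Metric.isCompact_of_isClosed_isBounded isClosed_closure hS.openSet.bounded.closure

lemma exists_diam_bound (hS : SimilaritySystem w lam V) :
    ∃ D > 0, ∀ y ∈ closure V, ∀ z ∈ closure V, dist y z ≤ D := by
  obtain ⟨C, hC⟩ := Metric.isBounded_iff.1 hS.openSet.bounded.closure
  exact ⟨max C 1, by positivity, fun y hy z hz => (hC hy hz).trans (le_max_left _ _)⟩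

/-- Boundedly many cells of level `n` meet a ball whose radius is comparable to their size. -/
lemma exists_card_le (hS : SimilaritySystem w lam V) (c : ℝ) :
    ∃ B : ℝ, ∀ n (y : EuclideanSpace ℝ (Fin N)) (s : Finset ((k : Fin n) → Fin (p k))),
      (∀ σ ∈ s, (wordMap w n σ '' closure V ∩ Metric.ball y (c * wordRatio lam n)).Nonempty) →
        s.card ≤ B := by
  obtain ⟨D, hD0, hD⟩ := hS.exists_diam_bound
  set d := Module.finrank ℝ (EuclideanSpace ℝ (Fin N)) with hd
  refine ⟨(D + |c|) ^ d * (haar N).real (Metric.ball 0 1) / (haar N).real V, fun n y s hs => ?_⟩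
  have hr := hS.wordRatio_pos n
  have hb := hS.card_mul_le n s
    (Metric.isBounded_closedBall (x := y) (r := (D + |c|) * wordRatio lam n)) (by
      rintro σ hσ _ ⟨v, hv, rfl⟩
      obtain ⟨_, ⟨u, hu, rfl⟩, huy⟩ := hs σ hσ
      have h1 := hS.dist_wordMap n σ v u
      have h2 := hD v (subset_closure hv) u hu
      have h3 := Metric.mem_ball.1 huy
      rw [Metric.mem_closedBall]
      have h4 : wordRatio lam n * dist v u ≤ wordRatio lam n * D := by gcongr
      have h5 : c * wordRatio lam n ≤ |c| * wordRatio lam n := by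
        gcongr
        exact le_abs_self c
      linarith [dist_triangle (wordMap w n σ v) (wordMap w n σ u) y])
  have hpos : 0 ≤ (D + |c|) * wordRatio lam n := by positivity
  rw [measureReal_def, measureReal_def, Measure.addHaar_closedBall _ _ hpos, ENNReal.toReal_mul,
    ENNReal.toReal_ofReal (by positivity), ← measureReal_def, ← measureReal_def, ← hd,
    mul_pow] at hb
  rw [le_div_iff₀ hS.haar_pos]
  have hrd : 0 < wordRatio lam n ^ d := by positivity
  refine le_of_mul_le_mul_right ?_ hrd
  linarith

lemma isClosed_translationFractal (hS : SimilaritySystem w lam V) :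
    IsClosed (translationFractal w V) := by
  refine isClosed_iInter fun n => isClosed_iUnion_of_finite fun σ => ?_
  exact (hS.isCompact_closure.image (hS.continuous_wordMap n σ)).isClosed

/-! ### The coding map and the canonical limit measure -/

/-- The initial word of length `n` of an infinite word. -/
def initialWord (n : ℕ) (ω : (k : ℕ) → Fin (p k)) : (k : Fin n) → Fin (p k) := fun k => ω k

lemma exists_code (hS : SimilaritySystem w lam V) (ω : (k : ℕ) → Fin (p k)) :
    ∃ z, ∀ n, z ∈ wordMap w n (initialWord n ω) '' closure V := by
  have := IsCompact.nonempty_iInter_of_sequence_nonempty_isCompact_isClosed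
    (fun n => wordMap w n (initialWord n ω) '' closure V)
    (fun n => hS.wordMap_succ_image_closure_subset n _)
    (fun n => hS.openSet.nonempty.closure.image _)
    (hS.isCompact_closure.image (hS.continuous_wordMap _ _))
    (fun n => (hS.isCompact_closure.image (hS.continuous_wordMap _ _)).isClosed)
  obtain ⟨z, hz⟩ := this
  exact ⟨z, mem_iInter.1 hz⟩

/-- The point of the fractal with a given code. -/
def code (hS : SimilaritySystem w lam V) (ω : (k : ℕ) → Fin (p k)) : EuclideanSpace ℝ (Fin N) :=
  (hS.exists_code ω).choose

lemma code_mem (hS : SimilaritySystem w lam V) (ω : (k : ℕ) → Fin (p k)) (n : ℕ) :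
    hS.code ω ∈ wordMap w n (initialWord n ω) '' closure V :=
  (hS.exists_code ω).choose_spec n

lemma code_mem_translationFractal (hS : SimilaritySystem w lam V) (ω : (k : ℕ) → Fin (p k)) :
    hS.code ω ∈ translationFractal w V :=
  mem_iInter.2 fun n => mem_iUnion.2 ⟨_, hS.code_mem ω n⟩

/-- Contraction makes the limit the same for every starting point, which is why the limit measure
does not depend on `μ₀`. -/
lemma tendsto_wordMap (hS : SimilaritySystem w lam V) (ω : (k : ℕ) → Fin (p k))
    (y : EuclideanSpace ℝ (Fin N)) :
    Tendsto (fun n => wordMap w n (initialWord n ω) y) atTop (𝓝 (hS.code ω)) := by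
  obtain ⟨D, -, hD⟩ := hS.exists_diam_bound
  obtain ⟨v, hv⟩ := hS.openSet.nonempty
  rw [tendsto_iff_dist_tendsto_zero]
  refine squeeze_zero (fun _ => dist_nonneg) (g := fun n => wordRatio lam n * (dist y v + D))
    (fun n => ?_) ?_
  · obtain ⟨u, hu, huz⟩ := hS.code_mem ω n
    rw [← huz, hS.dist_wordMap]
    have h1 := hD v (subset_closure hv) u hu
    have h2 := hS.wordRatio_pos n
    gcongr
    linarith [dist_triangle y v u]
  · simpa using hS.tendsto_wordRatio.mul_const (dist y v + D)

lemma measurable_initialWord (n : ℕ) : Measurable (initialWord (p := p) n) :=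
  measurable_pi_lambda _ fun _ => measurable_pi_apply _

lemma measurable_code (hS : SimilaritySystem w lam V) : Measurable hS.code := by
  refine measurable_of_tendsto_metrizable
    (f := fun n ω => wordMap w n (initialWord n ω) 0) (fun n => ?_) ?_
  · exact (measurable_of_countable fun σ => wordMap w n σ 0).comp (measurable_initialWord n)
  · exact tendsto_pi_nhds.2 fun ω => hS.tendsto_wordMap ω 0

/-- The uniform measure on infinite words. -/
def wordMeasure (p : ℕ → ℕ) : Measure ((k : ℕ) → Fin (p k)) :=
  Measure.infinitePi fun k => (p k : ℝ≥0∞)⁻¹ • Measure.count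

lemma isProbabilityMeasure_uniform (hS : SimilaritySystem w lam V) (k : ℕ) :
    IsProbabilityMeasure ((p k : ℝ≥0∞)⁻¹ • (Measure.count : Measure (Fin (p k)))) := by
  have : p k ≠ 0 := by linarith [hS.two_le k]
  constructor
  rw [Measure.smul_apply, Measure.count_apply MeasurableSet.univ, smul_eq_mul]
  simp only [encard_univ, ENat.card_eq_coe_fintype_card, Fintype.card_fin, ENat.toENNReal_coe]
  exact ENNReal.inv_mul_cancel (by simpa using this) (ENNReal.natCast_ne_top _)

lemma isProbabilityMeasure_wordMeasure (hS : SimilaritySystem w lam V) :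
    IsProbabilityMeasure (wordMeasure p) := by
  have := hS.isProbabilityMeasure_uniform
  rw [wordMeasure]
  infer_instance

lemma wordMeasure_cylinder (hS : SimilaritySystem w lam V) (n : ℕ) (σ : (k : Fin n) → Fin (p k)) :
    wordMeasure p {ω | initialWord n ω = σ} = (wordCount p n : ℝ≥0∞)⁻¹ := by
  have := hS.isProbabilityMeasure_uniform
  have hset : {ω : (k : ℕ) → Fin (p k) | initialWord n ω = σ} =
      Set.pi (Finset.range n) fun k =>
        if h : k < n then ({σ ⟨k, h⟩} : Set (Fin (p k))) else univ := by
    ext ω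
    simp only [mem_ofPred_eq, Set.mem_pi, Finset.coe_range, mem_Iio, funext_iff, initialWord]
    constructor
    · intro h k hk
      rw [dif_pos hk]
      exact h ⟨k, hk⟩
    · intro h k
      have := h k k.2
      rwa [dif_pos k.2] at this
  rw [hset, wordMeasure, Measure.infinitePi_pi _ (fun _ _ => MeasurableSet.of_discrete), wordCount,
    Nat.cast_prod, ENNReal.prod_inv_distrib]
  · refine Finset.prod_congr rfl fun k hk => ?_
    rw [dif_pos (Finset.mem_range.1 hk)]
    simp
  · exact fun i _ j _ _ => Or.inr (ENNReal.natCast_ne_top _)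

/-- The image of the uniform measure under the coding map. -/
def canonicalMeasure (hS : SimilaritySystem w lam V) : Measure (EuclideanSpace ℝ (Fin N)) :=
  (wordMeasure p).map hS.code

lemma isProbabilityMeasure_canonicalMeasure (hS : SimilaritySystem w lam V) :
    IsProbabilityMeasure hS.canonicalMeasure := by
  have := hS.isProbabilityMeasure_wordMeasure
  exact Measure.isProbabilityMeasure_map hS.measurable_code.aemeasurable

lemma integral_initialWord (hS : SimilaritySystem w lam V) (n : ℕ)
    (g : ((k : Fin n) → Fin (p k)) → ℝ) :
    ∫ ω, g (initialWord n ω) ∂(wordMeasure p) = (wordCount p n : ℝ)⁻¹ * ∑ σ, g σ := by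
  have := hS.isProbabilityMeasure_wordMeasure
  have := Measure.isProbabilityMeasure_map (μ := wordMeasure p)
    (measurable_initialWord n).aemeasurable
  have h := integral_map (μ := wordMeasure p) (measurable_initialWord n).aemeasurable
    (f := g) (measurable_of_countable g).aestronglyMeasurable
  rw [← h, integral_fintype Integrable.of_finite, Finset.mul_sum]
  refine Finset.sum_congr rfl fun σ _ => ?_
  rw [measureReal_def, Measure.map_apply (measurable_initialWord n) (measurableSet_singleton σ)]
  change (wordMeasure p {ω | initialWord n ω = σ}).toReal • g σ = _
  rw [hS.wordMeasure_cylinder, ENNReal.toReal_inv, ENNReal.toReal_natCast, smul_eq_mul]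

lemma integral_iterMeasure (hS : SimilaritySystem w lam V) (n : ℕ)
    (μ₀ : Measure (EuclideanSpace ℝ (Fin N))) [IsProbabilityMeasure μ₀]
    (f : EuclideanSpace ℝ (Fin N) →ᵇ ℝ) :
    ∫ y, f y ∂(iterMeasure w μ₀ n) =
      ∫ ω, (∫ y, f (wordMap w n (initialWord n ω) y) ∂μ₀) ∂(wordMeasure p) := by
  rw [hS.integral_initialWord n fun σ => ∫ y, f (wordMap w n σ y) ∂μ₀, iterMeasure,
    integral_smul_measure, integral_finsetSum_measure, ENNReal.toReal_inv, ENNReal.toReal_natCast,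
    smul_eq_mul, wordCount]
  · congr 1
    refine Finset.sum_congr rfl fun σ _ => ?_
    exact integral_map (hS.continuous_wordMap n σ).aemeasurable
      f.continuous.aestronglyMeasurable
  · intro σ _
    have := Measure.isProbabilityMeasure_map (μ := μ₀) (hS.continuous_wordMap n σ).aemeasurable
    exact f.integrable _

/-- The integral against `iterMeasure` is an average over infinite words of integrals over starting
points; dominated convergence applies in the starting point and then in the word. -/
lemma isCanonicalLimitMeasure (hS : SimilaritySystem w lam V) :
    IsCanonicalLimitMeasure w hS.canonicalMeasure := by
  have := hS.isProbabilityMeasure_wordMeasure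
  refine ⟨hS.isProbabilityMeasure_canonicalMeasure, fun μ₀ hμ₀ f => ?_⟩
  simp only [hS.integral_iterMeasure]
  rw [canonicalMeasure,
    integral_map hS.measurable_code.aemeasurable f.continuous.aestronglyMeasurable]
  refine tendsto_integral_of_dominated_convergence (fun _ => ‖f‖) (fun n => ?_)
    (integrable_const _) (fun n => Eventually.of_forall fun ω => ?_)
    (Eventually.of_forall fun ω => ?_)
  · exact ((measurable_of_countable fun σ => ∫ y, f (wordMap w n σ y) ∂μ₀).comp
      (measurable_initialWord n)).aestronglyMeasurable
  · refine (norm_integral_le_of_norm_le_const (C := ‖f‖)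
      (Eventually.of_forall fun y => f.norm_coe_le_norm _)).trans ?_
    simp
  · have h1 : ∫ _, f (hS.code ω) ∂μ₀ = f (hS.code ω) := by simp
    rw [← h1]
    refine tendsto_integral_of_dominated_convergence (fun _ => ‖f‖) (fun n => ?_)
      (integrable_const _) (fun n => Eventually.of_forall fun y => f.norm_coe_le_norm _)
      (Eventually.of_forall fun y => ?_)
    · exact (f.continuous.comp (hS.continuous_wordMap n _)).aestronglyMeasurable
    · exact (f.continuous.tendsto _).comp (hS.tendsto_wordMap ω y)

lemma eq_canonicalMeasure (hS : SimilaritySystem w lam V)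
    {μ : Measure (EuclideanSpace ℝ (Fin N))} (hμ : IsCanonicalLimitMeasure w μ) :
    μ = hS.canonicalMeasure := by
  have := hμ.isProbabilityMeasure
  have := hS.isProbabilityMeasure_canonicalMeasure
  refine ext_of_forall_integral_eq_of_IsFiniteMeasure fun f => ?_
  exact tendsto_nhds_unique (hμ.tendsto (Measure.dirac 0) inferInstance f)
    (hS.isCanonicalLimitMeasure.tendsto (Measure.dirac 0) inferInstance f)

lemma canonicalMeasure_compl (hS : SimilaritySystem w lam V) :
    hS.canonicalMeasure (translationFractal w V)ᶜ = 0 := by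
  rw [canonicalMeasure, Measure.map_apply hS.measurable_code
    hS.isClosed_translationFractal.measurableSet.compl]
  convert measure_empty (μ := wordMeasure p)
  exact eq_empty_of_forall_notMem fun ω hω => hω (hS.code_mem_translationFractal ω)

/-! ### Masses of balls in terms of cells -/

lemma real_cylinder (hS : SimilaritySystem w lam V) (n : ℕ) (σ : (k : Fin n) → Fin (p k)) :
    (wordMeasure p).real {ω | initialWord n ω = σ} = (wordCount p n : ℝ)⁻¹ := by
  rw [measureReal_def, hS.wordMeasure_cylinder, ENNReal.toReal_inv, ENNReal.toReal_natCast]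

/-- Balls which are larger than the cells of level `n`. -/
lemma inv_wordCount_le (hS : SimilaritySystem w lam V) {D : ℝ}
    (hD : ∀ y ∈ closure V, ∀ z ∈ closure V, dist y z ≤ D) {z : EuclideanSpace ℝ (Fin N)}
    (hz : z ∈ translationFractal w V) {n : ℕ} {r : ℝ} (hr : wordRatio lam n * D < r) :
    (wordCount p n : ℝ)⁻¹ ≤ hS.canonicalMeasure.real (Metric.ball z r) := by
  have := hS.isProbabilityMeasure_wordMeasure
  obtain ⟨σ, v, hv, hvz⟩ := mem_iUnion.1 (mem_iInter.1 hz n)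
  rw [← hS.real_cylinder n σ, canonicalMeasure,
    map_measureReal_apply hS.measurable_code measurableSet_ball]
  refine measureReal_mono fun ω hω => ?_
  have hω : initialWord n ω = σ := hω
  obtain ⟨u, hu, huω⟩ := hS.code_mem ω n
  rw [mem_preimage, Metric.mem_ball, ← huω, ← hvz, hω, hS.dist_wordMap]
  have := hS.wordRatio_pos n
  exact lt_of_le_of_lt (by gcongr; exact hD u hu v hv) hr

/-- Balls which are comparable to the cells of level `n`. -/
lemma canonicalMeasure_ball_le (hS : SimilaritySystem w lam V) {c B : ℝ}
    (hB : ∀ n (y : EuclideanSpace ℝ (Fin N)) (s : Finset ((k : Fin n) → Fin (p k))),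
      (∀ σ ∈ s, (wordMap w n σ '' closure V ∩ Metric.ball y (c * wordRatio lam n)).Nonempty) →
        s.card ≤ B) {n : ℕ} {r : ℝ} (hr : r ≤ c * wordRatio lam n)
    (y : EuclideanSpace ℝ (Fin N)) :
    hS.canonicalMeasure.real (Metric.ball y r) ≤ B * (wordCount p n : ℝ)⁻¹ := by
  classical
  have := hS.isProbabilityMeasure_wordMeasure
  set s : Finset ((k : Fin n) → Fin (p k)) := Finset.univ.filter fun σ =>
    (wordMap w n σ '' closure V ∩ Metric.ball y (c * wordRatio lam n)).Nonempty with hs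
  have hcard := hB n y s fun σ hσ => (Finset.mem_filter.1 hσ).2
  rw [canonicalMeasure, map_measureReal_apply hS.measurable_code measurableSet_ball]
  calc (wordMeasure p).real (hS.code ⁻¹' Metric.ball y r)
      ≤ (wordMeasure p).real (⋃ σ ∈ s, {ω | initialWord n ω = σ}) := by
        refine measureReal_mono (fun ω hω => ?_) (measure_ne_top _ _)
        refine mem_iUnion₂.2 ⟨initialWord n ω, Finset.mem_filter.2 ⟨Finset.mem_univ _, ?_⟩, rfl⟩
        exact ⟨hS.code ω, hS.code_mem ω n, Metric.ball_subset_ball hr hω⟩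
    _ ≤ ∑ σ ∈ s, (wordMeasure p).real {ω | initialWord n ω = σ} :=
        measureReal_biUnion_finset_le _ _
    _ = s.card * (wordCount p n : ℝ)⁻¹ := by simp [hS.real_cylinder]
    _ ≤ _ := by gcongr

/-- Take the first level whose cells have diameter bound below `r`. The small ball contains a cell
of that level, while `2r` is at most `2 D` times the ratio of the previous level, so the large ball
meets at most `B` cells there. One level costs at most the factor `b`. -/
theorem exists_uniformBalls (hS : SimilaritySystem w lam V) :
    ∃ A, UniformBalls (translationFractal w V) hS.canonicalMeasure A := by
  classical
  have hprob := hS.isProbabilityMeasure_canonicalMeasure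
  obtain ⟨D, hD0, hD⟩ := hS.exists_diam_bound
  obtain ⟨B, hB⟩ := hS.exists_card_le (2 * D)
  obtain ⟨b, hb⟩ := hS.bddAbove
  have hB0 : 0 ≤ B := by simpa using hB 0 0 ∅ (by simp)
  -- The summand `1` covers level `0`, where no previous level exists but the small ball already has
  -- full mass.
  refine ⟨1 + B * b, hprob, hS.canonicalMeasure_compl, fun y hy z hz r hr => ?_⟩
  have hex : ∃ n, wordRatio lam n * D < r := by
    have := (hS.tendsto_wordRatio.mul_const D).eventually_lt_const (show 0 * D < r by simpa)
    exact this.exists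
  have hlow := hS.inv_wordCount_le hD hz (Nat.find_spec hex)
  have hnn : 0 ≤ hS.canonicalMeasure.real (Metric.ball z r) := measureReal_nonneg
  rcases hn : Nat.find hex with _ | m
  · rw [hn] at hlow
    have h1 : (wordCount p 0 : ℝ)⁻¹ = 1 := by simp [wordCount]
    rw [h1] at hlow
    have h2 : hS.canonicalMeasure.real (Metric.ball y (2 * r)) ≤ 1 := measureReal_le_one
    have h3 : 0 ≤ B * b * hS.canonicalMeasure.real (Metric.ball z r) := by positivity
    linarith
  · have hm := not_lt.1 (Nat.find_min hex (m := m) (by omega))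
    have hup := hS.canonicalMeasure_ball_le hB (n := m) (r := 2 * r) (by linarith) y
    rw [hn] at hlow
    have hpm : (p m : ℝ) ≤ b := by exact_mod_cast hb ⟨m, rfl⟩
    have hpm0 : (0 : ℝ) < p m := by exact_mod_cast (by linarith [hS.two_le m] : 0 < p m)
    have hcm : (0 : ℝ) < wordCount p m := by exact_mod_cast hS.wordCount_pos m
    have e : (wordCount p m : ℝ)⁻¹ = p m * (wordCount p (m + 1) : ℝ)⁻¹ := by
      rw [wordCount, wordCount, Finset.prod_range_succ, Nat.cast_mul, mul_inv]
      field_simp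
    calc _ ≤ B * (wordCount p m : ℝ)⁻¹ := hup
      _ = B * (p m * (wordCount p (m + 1) : ℝ)⁻¹) := by rw [e]
      _ ≤ B * (b * hS.canonicalMeasure.real (Metric.ball z r)) := by gcongr
      _ ≤ _ := by linarith

end SimilaritySystem

end TangentialDim

end

open TangentialDim
theorem mainTheorem3 {N : ℕ} (p : ℕ → ℕ) (hp2 : ∀ n, 2 ≤ p n) (hp : BddAbove (Set.range p))
    (w : (n : ℕ) → Fin (p n) → EuclideanSpace ℝ (Fin N) → EuclideanSpace ℝ (Fin N))
    (lam : ℕ → ℝ) (hlam : ∀ n, lam n ∈ Set.Ioo (0 : ℝ) 1)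
    (hw : ∀ n j y z, dist (w n j y) (w n j z) = lam n * dist y z)
    (V : Set (EuclideanSpace ℝ (Fin N))) (hV : RegularOpenSetCondition w V) :
    (∃! μ : Measure (EuclideanSpace ℝ (Fin N)), IsCanonicalLimitMeasure w μ) ∧
    ∀ μ : Measure (EuclideanSpace ℝ (Fin N)), IsCanonicalLimitMeasure w μ →
      -- the measure lives on the fractal and has locally comparable balls there
      μ (translationFractal w V)ᶜ = 0 ∧
      LocallyComparableBalls (translationFractal w V) μ ∧
      ∀ x ∈ translationFractal w V,
        -- the tangential dimensions of the fractal and of the measure coincide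
        lowerTangDimSet (translationFractal w V) x = lowerTangDim μ x ∧
        upperTangDimSet (translationFractal w V) x = upperTangDim μ x ∧
        -- extrema over tangent measures
        lowerTangDim μ x = ⨅ ν ∈ tangentMeasures μ x, lowerLocalDim ν x ∧
        upperTangDim μ x = ⨆ ν ∈ tangentMeasures μ x, upperLocalDim ν x ∧
        -- extrema over tangent sets
        lowerTangDimSet (translationFractal w V) x =
          ⨅ T ∈ tangentSets (translationFractal w V) x, lowerLocalBoxDim T.base ∧
        lowerTangDimSet (translationFractal w V) x =
          ⨅ T ∈ tangentSets (translationFractal w V) x, upperLocalBoxDim T.base ∧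
        upperTangDimSet (translationFractal w V) x =
          ⨆ T ∈ tangentSets (translationFractal w V) x, lowerLocalBoxDim T.base ∧
        upperTangDimSet (translationFractal w V) x =
          ⨆ T ∈ tangentSets (translationFractal w V) x, upperLocalBoxDim T.base := by
  have hS : SimilaritySystem w lam V := ⟨hp2, hp, hlam, hw, hV⟩
  obtain ⟨A, hU⟩ := hS.exists_uniformBalls
  refine ⟨⟨_, hS.isCanonicalLimitMeasure, fun _ hμ => hS.eq_canonicalMeasure hμ⟩,
    fun μ hμ => ?_⟩
  rw [hS.eq_canonicalMeasure hμ]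
  refine ⟨hS.canonicalMeasure_compl, hU.locallyComparableBalls, fun x hx => ?_⟩
  rw [hU.lowerTangDimSet_eq hx, hU.upperTangDimSet_eq hx, hU.lowerTangDim_eq hx,
    hU.upperTangDim_eq hx]
  exact ⟨rfl, rfl, hU.tangLiminf_eq_iInf_tangentMeasures hx,
    hU.tangLimsup_eq_iSup_tangentMeasures hx, (hU.tangLiminf_eq_iInf_tangentSets hx).1,
    (hU.tangLiminf_eq_iInf_tangentSets hx).2, (hU.tangLimsup_eq_iSup_tangentSets hx).1,
    (hU.tangLimsup_eq_iSup_tangentSets hx).2⟩
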